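/- **Theorem 4.5.** Let $(R,\mathfrak m)$ be a Cohen–Macaulay (Noetherian) local ring of dimension $d\in\{1,2\}$ with infinite residue field, let $s\ge 1$, and let $I_1,\dots,I_s$ be $\mathfrak m$-primary ideals of $R$. For $n=(n_1,\dots,n_s)\in\mathbb Z^s$ put $\underline I^{n}=I_1^{n_1}\cdots I_s^{n_s}$, where $I_i^{n_i}=R$ if $n_i\le 0$, and $n^+=(\max(n_1,0),\dots,\max(n_s,0))$; order $\mathbb Z^s$ componentwise and let $e_1,\dots,e_s$ be its standard basis vectors. Let $\mathcal F=\{\mathcal F(n)\}_{n\in\mathbb Z^s}$ be an $\underline I$-admissible filtration, i.e. a family of ideals of $R$ such that for all $m,n\in\mathbb Z^s$: $\underline I^{n}\subseteq\mathcal F(n)$; $\mathcal F(n)\mathcal F(m)\subseteq\mathcal F(n+m)$; $\mathcal F(m)\subseteq\mathcal F(n)$ if $m\ge n$; $\mathcal F(n)=\mathcal F(n^+)$; and $\bigoplus_{n\in\mathbb Z^s}\mathcal F(n)t^n$ is a finite module over $\bigoplus_{n\in\mathbb Z^s}\underline I^{n}t^n$, where $t^n=t_1^{n_1}\cdots t_s^{n_s}$.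 Let $H_{\mathcal F}(n)=\lambda(R/\mathcal F(n))$ (length) be the Hilbert function of $\mathcal F$, and let $$P_{\mathcal F}(n)=\sum_{\alpha\in\mathbb N^s,\ |\alpha|\le d}(-1)^{d-|\alpha|}e_\alpha(\mathcal F)\binom{n_1+\alpha_1-1}{\alpha_1}\cdots\binom{n_s+\alpha_s-1}{\alpha_s},\qquad e_\alpha(\mathcal F)\in\mathbb Z,$$ be its Hilbert polynomial, i.e. the polynomial of this form with $P_{\mathcal F}(n)=H_{\mathcal F}(n)$ whenever all $n_i$ are sufficiently large. Put $\mathcal R(\underline I)=\bigoplus_{n\in\mathbb N^s}\underline I^{n}t^n$, $\mathcal R(\mathcal F)=\bigoplus_{n\in\mathbb N^s}\mathcal F(n)t^n$ and $\mathcal R_{++}=\bigoplus_{n\ge(1,\dots,1)}\underline I^{n}t^n$, an ideal of $\mathcal R(\underline I)$, and let $H^1_{\mathcal R_{++}}(\mathcal R(\mathcal F))$ be the first local cohomology module of the graded $\mathcal R(\underline I)$-module $\mathcal R(\mathcal F)$ with support in $\mathcal R_{++}$, with its $\mathbb Z^s$-grading. Assume that $e_{(d-1)e_i}(\mathcal F)=0$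 for $i=1,\dots,s$. 1. If $d=1$, then $P_{\mathcal F}(n)=H_{\mathcal F}(n)$ for all $n\in\mathbb N^s$. 2. If $d=2$ and $H^1_{\mathcal R_{++}}(\mathcal R(\mathcal F))_n=0$ for all $n\in\mathbb N^s$, then $P_{\mathcal F}(n)=H_{\mathcal F}(n)$ for all $n\in\mathbb N^s$ and $e_{(0,\dots,0)}(\mathcal F)=0$. -/

import Mathlib

open IsLocalRing

noncomputable section

/-! ### Cohen-Macaulay local rings -/

/-- A Noetherian local ring is Cohen-Macaulay if `depth R = dim R`, i.e. if its maximal ideal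
contains an `R`-regular sequence whose length is the Krull dimension of `R`. -/
def IsCohenMacaulayLocal (R : Type*) [CommRing R] [IsLocalRing R] : Prop :=
  ∃ rs : List R, (∀ r ∈ rs, r ∈ maximalIdeal R) ∧
    RingTheory.Sequence.IsRegular R rs ∧ (rs.length : WithBot ℕ∞) = ringKrullDim R

/-! ### Multigraded filtrations -/

section Filtrations

variable {R : Type*} [CommRing R] {s : ℕ}

/-- The ideal `I₁^{n₁} ⋯ Iₛ^{nₛ}` for `n ∈ ℤ^s`, with the convention `Iᵢ^{nᵢ} = R` if `nᵢ ≤ 0`. -/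
def multiPow (I : Fin s → Ideal R) (n : Fin s → ℤ) : Ideal R :=
  ∏ i, I i ^ (n i).toNat

/-- A `ℤ^s`-graded `I = (I₁, …, Iₛ)`-filtration. -/
structure MultiFiltration (I : Fin s → Ideal R) where
  /-- the ideals of the filtration -/
  ideal : (Fin s → ℤ) → Ideal R
  multiPow_le : ∀ n, multiPow I n ≤ ideal n
  mul_le : ∀ n m, ideal n * ideal m ≤ ideal (n + m)
  anti : ∀ m n, n ≤ m → ideal m ≤ ideal n

/-! ### Rees rings and Rees modules

They are realised inside the Laurent polynomial ring `R[t₁^{±1}, …, tₛ^{±1}]`, which is the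
algebra of the additive group `ℤ^s`; the coefficient of `f` at `t^n` is `f.coeff n`. -/

/-- The Laurent polynomial ring `R[t₁^{±1}, …, tₛ^{±1}]`. -/
abbrev LaurentRing (R : Type*) [CommRing R] (s : ℕ) : Type _ := AddMonoidAlgebra R (Fin s → ℤ)

theorem laurent_coeff_mul_mem {f g : LaurentRing R s} {n : Fin s → ℤ} {J : Ideal R}
    (h : ∀ a b, a + b = n → f.coeff a * g.coeff b ∈ J) : (f * g).coeff n ∈ J := by
  classical
  rw [AddMonoidAlgebra.coeff_mul]
  simp only [Finsupp.sum]
  refine Ideal.sum_mem _ fun a _ => Ideal.sum_mem _ fun b _ => ?_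
  split_ifs with hab
  · exact h a b hab
  · exact J.zero_mem

theorem multiPow_mul_le (I : Fin s → Ideal R) (n m : Fin s → ℤ) :
    multiPow I n * multiPow I m ≤ multiPow I (n + m) := by
  unfold multiPow
  rw [← Finset.prod_mul_distrib]
  refine Finset.prod_le_prod' fun i _ => ?_
  rw [← pow_add]
  refine Ideal.pow_le_pow_right ?_
  simp only [Pi.add_apply]
  omega

/-- The subalgebra `⨁ₙ a(n) tⁿ` of the Laurent polynomial ring, for a multiplicative family of
ideals `a`. -/
def familySubalgebra (a : (Fin s → ℤ) → Ideal R) (h0 : a 0 = ⊤)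
    (hmul : ∀ n m, a n * a m ≤ a (n + m)) : Subalgebra R (LaurentRing R s) where
  carrier := {f | ∀ n, f.coeff n ∈ a n}
  mul_mem' := fun {f g} hf hg n => laurent_coeff_mul_mem fun k l hkl =>
    hkl ▸ hmul k l (Ideal.mul_mem_mul (hf k) (hg l))
  add_mem' := fun {f g} hf hg n => by
    simpa using Ideal.add_mem _ (hf n) (hg n)
  algebraMap_mem' := fun r n => by
    classical
    rw [AddMonoidAlgebra.coe_algebraMap]
    simp only [Function.comp_apply, AddMonoidAlgebra.coeff_single, Finsupp.single_apply]
    split_ifs with h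
    · rw [← h, h0]; exact Submodule.mem_top
    · exact (a n).zero_mem

/-- The submodule `⨁ₙ b(n) tⁿ` of the Laurent polynomial ring over `⨁ₙ a(n) tⁿ`. -/
def familySubmodule (a : (Fin s → ℤ) → Ideal R) (h0 : a 0 = ⊤)
    (hmul : ∀ n m, a n * a m ≤ a (n + m)) (b : (Fin s → ℤ) → Ideal R)
    (hb : ∀ n m, a n * b m ≤ b (n + m)) :
    Submodule (familySubalgebra a h0 hmul) (LaurentRing R s) where
  carrier := {f | ∀ n, f.coeff n ∈ b n}
  add_mem' := fun {f g} hf hg n => by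
    simpa using Ideal.add_mem _ (hf n) (hg n)
  zero_mem' := fun n => by simp
  smul_mem' := fun c f hf n => laurent_coeff_mul_mem fun k l hkl =>
    hkl ▸ hb k l (Ideal.mul_mem_mul (c.2 k) (hf l))

/-- Truncation of a `ℤ^s`-indexed family of ideals to the degrees `n ≥ c`. -/
def truncFamily (c : Fin s → ℤ) (a : (Fin s → ℤ) → Ideal R) (n : Fin s → ℤ) : Ideal R :=
  open Classical in if c ≤ n then a n else ⊥

theorem multiPow_zero (I : Fin s → Ideal R) : multiPow I 0 = ⊤ := by
  simp [multiPow, ← Ideal.one_eq_top]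

theorem truncFamily_multiPow_zero (I : Fin s → Ideal R) :
    truncFamily 0 (multiPow I) 0 = ⊤ := by
  simp [truncFamily, multiPow_zero]

theorem truncFamily_mul_le (c d : Fin s → ℤ) (a b : (Fin s → ℤ) → Ideal R)
    (h : ∀ n m, a n * b m ≤ b (n + m)) (hcd : c + d = d) (n m : Fin s → ℤ) :
    truncFamily c a n * truncFamily d b m ≤ truncFamily d b (n + m) := by
  unfold truncFamily
  split_ifs with h1 h2 h3 h3
  · exact h n m
  · exact absurd (hcd ▸ add_le_add h1 h2) h3
  all_goals simp

theorem MultiFiltration.multiPow_mul_ideal_le {I : Fin s → Ideal R} (F : MultiFiltration I)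
    (n m : Fin s → ℤ) : multiPow I n * F.ideal m ≤ F.ideal (n + m) :=
  (Ideal.mul_mono_left (F.multiPow_le n)).trans (F.mul_le n m)

/-- The `ℤ^s`-graded extended Rees ring `R'(I) = ⨁_{n ∈ ℤ^s} Iⁿ tⁿ`. -/
abbrev extReesRing (I : Fin s → Ideal R) : Subalgebra R (LaurentRing R s) :=
  familySubalgebra (multiPow I) (multiPow_zero I) (multiPow_mul_le I)

/-- The `ℤ^s`-graded extended Rees ring `R'(F) = ⨁_{n ∈ ℤ^s} F(n) tⁿ`, as an `R'(I)`-module. -/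
abbrev extReesModule {I : Fin s → Ideal R} (F : MultiFiltration I) :
    Submodule (extReesRing I) (LaurentRing R s) :=
  familySubmodule _ _ _ F.ideal F.multiPow_mul_ideal_le

/-- The `ℕ^s`-graded Rees ring `R(I) = ⨁_{n ≥ 0} Iⁿ tⁿ`. -/
abbrev reesRing (I : Fin s → Ideal R) : Subalgebra R (LaurentRing R s) :=
  familySubalgebra (truncFamily 0 (multiPow I)) (truncFamily_multiPow_zero I)
    (truncFamily_mul_le 0 0 _ _ (multiPow_mul_le I) (zero_add 0))

/-- The `ℕ^s`-graded Rees ring `R(F) = ⨁_{n ≥ 0} F(n) tⁿ`, as an `R(I)`-module. -/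
abbrev reesModule {I : Fin s → Ideal R} (F : MultiFiltration I) :
    Submodule (reesRing I) (LaurentRing R s) :=
  familySubmodule _ _ _ (truncFamily 0 F.ideal)
    (truncFamily_mul_le 0 0 _ _ F.multiPow_mul_ideal_le (zero_add 0))

/-- The ideal `R(I)₊₊ = ⨁_{n ≥ (1,…,1)} Iⁿ tⁿ` of `R(I)`. -/
def reesIrrelevant (I : Fin s → Ideal R) : Ideal (reesRing I) :=
  (familySubmodule _ (truncFamily_multiPow_zero I)
    (truncFamily_mul_le 0 0 _ _ (multiPow_mul_le I) (zero_add 0)) (truncFamily 1 (multiPow I))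
    (truncFamily_mul_le 0 1 _ _ (multiPow_mul_le I) (zero_add 1))).comap
    (Algebra.linearMap (reesRing I) (LaurentRing R s))

/-- A Laurent polynomial is homogeneous of degree `n` if only `tⁿ` occurs in it. -/
def IsLaurentHomogeneous (n : Fin s → ℤ) (f : LaurentRing R s) : Prop :=
  ∀ k, k ≠ n → f.coeff k = 0

/-- The component `R(F)ₙ` of degree `n` of the graded module `R(F)`. -/
def reesComponent {I : Fin s → Ideal R} (F : MultiFiltration I) (n : Fin s → ℤ) :
    AddSubgroup (reesModule F) where
  carrier := {f | IsLaurentHomogeneous n (f : LaurentRing R s)}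
  add_mem' := fun {f g} hf hg k hk => by simp [hf k hk, hg k hk]
  zero_mem' := fun k _ => by simp
  neg_mem' := fun {f} hf k hk => by simp [hf k hk]

/-- An `I`-filtration `F` is `I`-admissible if `F(n) = F(n⁺)` for all `n` and `R'(F)` is a finite
`R'(I)`-module. -/
def MultiFiltration.IsAdmissible {I : Fin s → Ideal R} (F : MultiFiltration I) : Prop :=
  (∀ n, F.ideal n = F.ideal (n ⊔ 0)) ∧ Module.Finite (extReesRing I) (extReesModule F)

/-! ### Hilbert function, Hilbert polynomial, Hilbert coefficients -/

/-- The Hilbert function `H_F(n) = λ(R / F(n))`. (If the ideals `Iᵢ` are primary to the maximal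
ideal, these lengths are finite, because `Iⁿ ⊆ F(n)`.) -/
def MultiFiltration.hilbertFunction {I : Fin s → Ideal R} (F : MultiFiltration I)
    (n : Fin s → ℤ) : ℤ :=
  (Module.length R (R ⧸ F.ideal n)).toNat

/-- The value at `n ∈ ℤ^s` of the numerical polynomial
`∑_{|α| ≤ d} (-1)^{d-|α|} e_α ∏ᵢ binom(nᵢ + αᵢ - 1, αᵢ)`. -/
def numericalPoly (d : ℕ) (e : (Fin s → ℕ) → ℤ) (n : Fin s → ℤ) : ℤ :=
  ∑ α ∈ (Finset.Iic (fun _ : Fin s => d)).filter (fun α => ∑ i, α i ≤ d),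
    (-1) ^ (d - ∑ i, α i) * e α * ∏ i, Ring.choose (n i + α i - 1) (α i)

/-- The integers `e_α`, `|α| ≤ d`, are Hilbert coefficients of `F` in dimension `d`: the numerical
polynomial that they define agrees with `H_F(n)` for all large `n`. -/
def MultiFiltration.IsHilbertCoeff {I : Fin s → Ideal R} (F : MultiFiltration I) (d : ℕ)
    (e : (Fin s → ℕ) → ℤ) : Prop :=
  ∃ N : Fin s → ℤ, ∀ n, N ≤ n → numericalPoly d e n = F.hilbertFunction n

/-- The Hilbert coefficients `e_α(F)`, `|α| ≤ d`, of a filtration in a ring of dimension `d`. They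
are determined by the condition above; where no such integers exist (never for an admissible
filtration in a Noetherian local ring of dimension `d`) the value is the meaningless `0`. -/
def MultiFiltration.hilbertCoeff {I : Fin s → Ideal R} (F : MultiFiltration I) (d : ℕ) :
    (Fin s → ℕ) → ℤ :=
  open Classical in if h : ∃ e, F.IsHilbertCoeff d e then h.choose else 0

/-- The Hilbert polynomial `P_F(n)` of a filtration in a ring of dimension `d`. -/
def MultiFiltration.hilbertPoly {I : Fin s → Ideal R} (F : MultiFiltration I) (d : ℕ)
    (n : Fin s → ℤ) : ℤ :=
  numericalPoly d (F.hilbertCoeff d) n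

end Filtrations

/-! ### First local cohomology through the Čech complex -/

section Cech

variable {S : Type*} [CommRing S] (M : Type*) [AddCommGroup M] [Module S M]

theorem isUnit_algebraMap_away_of_dvd {a c : S} (h : a ∣ c) (y : Submonoid.powers a) :
    IsUnit (algebraMap S (Module.End S (LocalizedModule (Submonoid.powers c) M)) y) := by
  obtain ⟨b, rfl⟩ := h
  obtain ⟨_, k, rfl⟩ := y
  have hu := IsLocalizedModule.map_units
    (LocalizedModule.mkLinearMap (Submonoid.powers (a * b)) M)
    ⟨a * b, Submonoid.mem_powers _⟩
  simp only [map_mul] at hu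
  have hc : Commute (algebraMap S (Module.End S (LocalizedModule (Submonoid.powers (a * b)) M)) a)
      (algebraMap S _ b) := Algebra.commutes a _
  simpa using ((hc.isUnit_mul_iff.mp hu).1).pow k

/-- The canonical map `M_a → M_c` between localizations at powers of elements `a ∣ c`. -/
def awayMap {a c : S} (h : a ∣ c) :
    LocalizedModule (Submonoid.powers a) M →ₗ[S] LocalizedModule (Submonoid.powers c) M :=
  LocalizedModule.lift (Submonoid.powers a) (LocalizedModule.mkLinearMap (Submonoid.powers c) M)
    (isUnit_algebraMap_away_of_dvd M h)

variable {m : ℕ} (x : Fin m → S)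

/-- The differential `M → ∏ᵢ M_{xᵢ}` of the Čech complex of `M` on `x₁, …, xₘ`. -/
def cechD0 : M →ₗ[S] (∀ i, LocalizedModule (Submonoid.powers (x i)) M) :=
  LinearMap.pi fun i => LocalizedModule.mkLinearMap (Submonoid.powers (x i)) M

/-- The differential `∏ᵢ M_{xᵢ} → ∏_{i<j} M_{xᵢxⱼ}`, `(cᵢ) ↦ (cⱼ - cᵢ)`, of the Čech complex. -/
def cechD1 : (∀ i, LocalizedModule (Submonoid.powers (x i)) M) →ₗ[S]
    (∀ p : {p : Fin m × Fin m // p.1 < p.2},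
      LocalizedModule (Submonoid.powers (x p.1.1 * x p.1.2)) M) :=
  LinearMap.pi fun p =>
    (awayMap M (Dvd.intro_left (x p.1.1) rfl)).comp (LinearMap.proj p.1.2) -
      (awayMap M (Dvd.intro (x p.1.2) rfl)).comp (LinearMap.proj p.1.1)

/-- The first local cohomology module `H¹_{(x₁, …, xₘ)}(M)` of a module over a Noetherian ring: the
first cohomology of the Čech complex `M → ∏ᵢ M_{xᵢ} → ∏_{i<j} M_{xᵢxⱼ} → ⋯`. -/
abbrev CechH1 : Type _ :=
  LinearMap.ker (cechD1 M x) ⧸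
    (LinearMap.range (cechD0 M x)).submoduleOf (LinearMap.ker (cechD1 M x))

variable {M} {G : Type*} [AddCommGroup G] (comp : G → AddSubgroup M) (δ : Fin m → G)

/-- `z ∈ M_a` is homogeneous of degree `n`, where `a` has degree `g` and `comp` is the grading of
`M`: it is of the form `u / a^k` with `u` of degree `n + k g`. -/
def IsAwayHomogeneous (a : S) (g n : G) (z : LocalizedModule (Submonoid.powers a) M) : Prop :=
  ∃ (k : ℕ) (u : M), u ∈ comp (n + k • g) ∧
    z = LocalizedModule.mk u ⟨a ^ k, Submonoid.pow_mem _ (Submonoid.mem_powers a) k⟩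

/-- The component of degree `n` of `H¹_{(x₁, …, xₘ)}(M)`, where `M` is graded by `comp` and `xᵢ` is
homogeneous of degree `δᵢ`: the classes of the cocycles of degree `n`. -/
def cechH1Component (n : G) : AddSubgroup (CechH1 M x) :=
  AddSubgroup.closure {h | ∃ c : LinearMap.ker (cechD1 M x),
    (∀ i, IsAwayHomogeneous comp (x i) (δ i) n (c.1 i)) ∧ h = Submodule.Quotient.mk c}

end Cech

end

/-!
Both cases compare `H_F` with `P_F` through their differences. Since the extended Rees ring is
Noetherian and the residue field is infinite, a general element of `Iᵢ` is superficial. If `d = 1`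
it generates a reduction, and if `d = 2` general elements `a ∈ Iᵢ` and `b ∈ Iⱼ` form a joint
reduction; comparing lengths, the first (second) differences of `H_F` never exceed the constants
`λ(R/(a))` (`λ(R/(a, b))`), to which they are eventually equal and which are therefore the
differences of `P_F`. For `d = 2` this inequality holds in the degrees `n` in which `F(n)` is
Ratliff-Rush closed, and a failure of this in degree `n ≥ 0` is a nonzero class in `H¹` of degree
`n`. Now `H_F - P_F` (or its first differences, if `d = 2`) is eventually zero, does not increase
on `ℕ^s`, and starts with a value `≤ 0`, because `H_F` vanishes for `n ≤ 0` and
`e_{(d-1)eᵢ} ≤ 0`. Hence it vanishes on `ℕ^s`.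
-/

noncomputable section

/-! ### Finite families of ideals -/

section FiniteFamilies

variable {R : Type*} [CommRing R] {s : ℕ}

theorem laurent_mem_of_single_coeff_mem {σ : Type*} [SetLike σ (LaurentRing R s)]
    [AddSubmonoidClass σ (LaurentRing R s)] {N : σ} {f : LaurentRing R s}
    (h : ∀ n, AddMonoidAlgebra.single n (f.coeff n) ∈ N) : f ∈ N := by
  rw [← AddMonoidAlgebra.sum_coeff_single f]
  exact sum_mem fun n _ => h n

theorem single_coeff_mem_iff {b : (Fin s → ℤ) → Ideal R} {n : Fin s → ℤ} {c : R} :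
    (∀ m, (AddMonoidAlgebra.single n c : LaurentRing R s).coeff m ∈ b m) ↔ c ∈ b n := by
  classical
  refine ⟨fun h => by simpa using h n, fun hc m => ?_⟩
  rw [AddMonoidAlgebra.coeff_single, Finsupp.single_apply]
  split_ifs with h
  · exact h ▸ hc
  · exact zero_mem _

theorem multiPow_of_nonpos (I : Fin s → Ideal R) {n : Fin s → ℤ} (hn : n ≤ 0) :
    multiPow I n = ⊤ := by
  rw [← Ideal.one_eq_top]
  refine Finset.prod_eq_one fun i _ => ?_
  rw [Int.toNat_of_nonpos (hn i), pow_zero]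

theorem multiPow_single (I : Fin s → Ideal R) (i : Fin s) (z : ℤ) :
    multiPow I (Pi.single i z) = I i ^ z.toNat := by
  rw [multiPow, Finset.prod_eq_single i]
  · rw [Pi.single_eq_same]
  · intro j _ hj
    simp [hj]
  · simp

theorem multiPow_single_one (I : Fin s → Ideal R) (i : Fin s) :
    multiPow I (Pi.single i 1) = I i := by
  simp [multiPow_single]

theorem multiPow_map {R' : Type*} [CommRing R'] (I : Fin s → Ideal R) (φ : R →+* R')
    (n : Fin s → ℤ) : multiPow (fun i => (I i).map φ) n = (multiPow I n).map φ := by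
  simp only [multiPow, ← Ideal.mapHom_apply, map_prod, map_pow]

theorem multiPow_eq_pow_mul_sub_single (I : Fin s → Ideal R) {n : Fin s → ℤ} {i : Fin s} {k : ℕ}
    (hk : k ≤ n i) : multiPow I n = I i ^ k * multiPow I (n - Pi.single i (k : ℤ)) := by
  classical
  rw [multiPow, multiPow, ← Finset.mul_prod_erase _ _ (Finset.mem_univ i),
    ← Finset.mul_prod_erase (a := i) _ _ (Finset.mem_univ i), ← mul_assoc, ← pow_add]
  congr 1
  · congr 1
    simp only [Pi.sub_apply, Pi.single_eq_same]
    omega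
  · refine Finset.prod_congr rfl fun j hj => ?_
    simp [Finset.ne_of_mem_erase hj]

theorem pow_toNat_le_of_multiplicative {f : ℤ → Ideal R} {J : Ideal R} (h0 : f 0 = ⊤)
    (hmul : ∀ k l, f k * f l ≤ f (k + l)) (hJ : J ≤ f 1) (hneg : f (-1) = ⊤) (z : ℤ) :
    J ^ z.toNat ≤ f z := by
  induction z with
  | zero => simp [h0]
  | succ k ih =>
    rw [Int.toNat_natCast_add_one, pow_succ]
    exact (Ideal.mul_mono ih hJ).trans (hmul _ _)
  | pred k ih =>
    rw [Int.toNat_neg_natCast, pow_zero, Ideal.one_eq_top] at ih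
    calc J ^ (-(k : ℤ) - 1).toNat ≤ f (-k) * f (-1) := by simp [top_le_iff.mp ih, hneg]
      _ ≤ f (-k - 1) := hmul _ _

theorem multiPow_le_of_multiplicative {I : Fin s → Ideal R} {a : (Fin s → ℤ) → Ideal R}
    (h0 : a 0 = ⊤) (hmul : ∀ n m, a n * a m ≤ a (n + m)) (hI : ∀ i, I i ≤ a (Pi.single i 1))
    (hneg : ∀ i, a (Pi.single i (-1)) = ⊤) (n : Fin s → ℤ) : multiPow I n ≤ a n := by
  classical
  have hsingle (i : Fin s) : I i ^ (n i).toNat ≤ a (Pi.single i (n i)) :=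
    pow_toNat_le_of_multiplicative (f := fun z => a (Pi.single i z)) (by simpa using h0)
      (fun k l => by simpa only [Pi.single_add] using hmul _ _) (hI i) (hneg i) _
  have hsum (t : Finset (Fin s)) :
      ∏ i ∈ t, I i ^ (n i).toNat ≤ a (∑ i ∈ t, Pi.single i (n i)) := by
    induction t using Finset.induction_on with
    | empty => simp [h0]
    | insert i t hi ih =>
      rw [Finset.prod_insert hi, Finset.sum_insert hi]
      exact (Ideal.mul_mono (hsingle i) ih).trans (hmul _ _)
  exact (hsum Finset.univ).trans_eq (by rw [Finset.univ_sum_single])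

theorem extReesRing_le {I : Fin s → Ideal R} {A : Subalgebra R (LaurentRing R s)}
    (hpos : ∀ i, ∀ c ∈ I i, AddMonoidAlgebra.single (Pi.single i 1) c ∈ A)
    (hneg : ∀ i, AddMonoidAlgebra.single (Pi.single i (-1)) 1 ∈ A) : extReesRing I ≤ A := by
  let a (n : Fin s → ℤ) : Ideal R :=
    (Subalgebra.toSubmodule A).comap (AddMonoidAlgebra.lsingle n)
  have hle (n : Fin s → ℤ) : multiPow I n ≤ a n := by
    refine multiPow_le_of_multiplicative ((Ideal.eq_top_iff_one _).mpr A.one_mem)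
      (fun n m => Ideal.mul_le.mpr fun x hx y hy => ?_) hpos
      (fun i => (Ideal.eq_top_iff_one _).mpr (hneg i)) n
    have hxy := A.mul_mem hx hy
    rwa [AddMonoidAlgebra.lsingle_apply, AddMonoidAlgebra.lsingle_apply,
      AddMonoidAlgebra.single_mul_single] at hxy
  exact fun f hf => laurent_mem_of_single_coeff_mem fun n => hle n (hf n)

theorem extReesRing_fg [IsNoetherianRing R] (I : Fin s → Ideal R) : (extReesRing I).FG := by
  classical
  choose g hg using fun i => IsNoetherian.noetherian (I i)
  let T : Finset (LaurentRing R s) :=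
    (Finset.univ.biUnion fun i => (g i).image (AddMonoidAlgebra.single (Pi.single i 1))) ∪
      Finset.univ.image fun i => AddMonoidAlgebra.single (Pi.single i (-1)) 1
  have hg_mem {i : Fin s} {c : R} (hc : c ∈ g i) :
      AddMonoidAlgebra.single (Pi.single i 1) c ∈ T :=
    Finset.mem_union_left _
      (Finset.mem_biUnion.mpr ⟨i, Finset.mem_univ i, Finset.mem_image_of_mem _ hc⟩)
  have hneg_mem (i : Fin s) : AddMonoidAlgebra.single (Pi.single i (-1)) 1 ∈ T :=
    Finset.mem_union_right _ (Finset.mem_image_of_mem _ (Finset.mem_univ i))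
  refine ⟨T, le_antisymm (Algebra.adjoin_le fun f hf => ?_) (extReesRing_le (fun i => ?_)
    fun i => Algebra.subset_adjoin (hneg_mem i))⟩
  · simp only [T, Finset.mem_coe, Finset.mem_union, Finset.mem_biUnion, Finset.mem_image,
      Finset.mem_univ, true_and] at hf
    rcases hf with ⟨i, c, hc, rfl⟩ | ⟨i, rfl⟩ <;> refine single_coeff_mem_iff.mpr ?_
    · rw [multiPow_single_one, ← hg i]
      exact Submodule.subset_span hc
    · rw [multiPow_of_nonpos _ (Pi.single_nonpos.mpr (by norm_num))]
      exact Submodule.mem_top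
  · change I i ≤ (Subalgebra.toSubmodule (Algebra.adjoin R (T : Set (LaurentRing R s)))).comap
      (AddMonoidAlgebra.lsingle (Pi.single i 1))
    rw [← hg i, Submodule.span_le]
    exact fun c hc => Algebra.subset_adjoin (hg_mem hc)

theorem extReesRing_isNoetherianRing [IsNoetherianRing R] (I : Fin s → Ideal R) :
    IsNoetherianRing (extReesRing I) := by
  have : Algebra.FiniteType R (extReesRing I) :=
    (extReesRing I).fg_iff_finiteType.mp (extReesRing_fg I)
  exact Algebra.FiniteType.isNoetherianRing R _

/-- The family `b` satisfies `Iⁿ b(m) ⊆ b(n + m)`, i.e. `⨁ b(n) tⁿ` is a module over the extended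
Rees ring of `I`. -/
def IsMultiPowStable (I : Fin s → Ideal R) (b : (Fin s → ℤ) → Ideal R) : Prop :=
  ∀ n m, multiPow I n * b m ≤ b (n + m)

/-- The family `b` is finite over `I` if finitely many of its members generate the others, i.e. if
`⨁ b(n) tⁿ` is a finite module over the extended Rees ring of `I`. -/
def IsFiniteFamily (I : Fin s → Ideal R) (b : (Fin s → ℤ) → Ideal R) : Prop :=
  ∃ D : Finset (Fin s → ℤ), ∀ n, b n ≤ ⨆ p ∈ D, multiPow I (n - p) * b p

variable {I : Fin s → Ideal R} {b c : (Fin s → ℤ) → Ideal R}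

namespace IsMultiPowStable

theorem shift (hb : IsMultiPowStable I b) (q : Fin s → ℤ) :
    IsMultiPowStable I fun n => b (n + q) := fun n m => by
  simpa only [add_assoc] using hb n (m + q)

theorem map {R' : Type*} [CommRing R'] (hb : IsMultiPowStable I b) (φ : R →+* R') :
    IsMultiPowStable (fun i => (I i).map φ) fun n => (b n).map φ := fun n m => by
  rw [multiPow_map, ← Ideal.map_mul]
  exact Ideal.map_mono (hb n m)

theorem colon (hb : IsMultiPowStable I b) (J : Set R) :
    IsMultiPowStable I fun n => (b n).colon J := fun n m => by
  refine Ideal.mul_le.mpr fun x hx y hy => Submodule.mem_colon.mpr fun z hz => ?_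
  rw [smul_eq_mul, mul_assoc]
  exact hb n m (Ideal.mul_mem_mul hx (Submodule.mem_colon.mp hy z hz))

theorem mul_mem_add_single (hb : IsMultiPowStable I b) {i : Fin s} {a x : R} (ha : a ∈ I i)
    {n : Fin s → ℤ} (hx : x ∈ b n) : a * x ∈ b (n + Pi.single i 1) := by
  rw [add_comm]
  exact hb _ n (Ideal.mul_mem_mul (by rwa [multiPow_single_one]) hx)

/-- The module `⨁ b(n) tⁿ` over the extended Rees ring. -/
abbrev familyModule (hb : IsMultiPowStable I b) :
    Submodule (extReesRing I) (LaurentRing R s) :=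
  familySubmodule _ (multiPow_zero I) (multiPow_mul_le I) b hb

theorem isFiniteFamily_of_familyModule_fg (hb : IsMultiPowStable I b)
    (h : hb.familyModule.FG) : IsFiniteFamily I b := by
  classical
  obtain ⟨T, hT⟩ := h
  let D : Finset (Fin s → ℤ) := T.biUnion fun f => f.coeff.support
  have hc : IsMultiPowStable I fun n => ⨆ p ∈ D, multiPow I (n - p) * b p := by
    intro n m
    simp only [Ideal.mul_iSup]
    refine iSup₂_mono fun p _ => ?_
    rw [← mul_assoc, add_sub_assoc]
    exact Ideal.mul_mono_left (multiPow_mul_le I n _)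
  have hle : hb.familyModule ≤ hc.familyModule := by
    rw [← hT, Submodule.span_le]
    intro f hf n
    by_cases hn : f.coeff n = 0
    · exact hn ▸ zero_mem _
    · have hnD : n ∈ D := Finset.mem_biUnion.mpr ⟨f, hf, Finsupp.mem_support_iff.mpr hn⟩
      have hfb : f ∈ hb.familyModule := hT ▸ Submodule.subset_span hf
      refine Submodule.mem_iSup_of_mem n (Submodule.mem_iSup_of_mem hnD ?_)
      rw [sub_self, multiPow_zero, Ideal.top_mul]
      exact hfb n
  exact ⟨D, fun n x hx => single_coeff_mem_iff.mp (hle (single_coeff_mem_iff.mpr hx))⟩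

theorem familyModule_fg [IsNoetherianRing R] (hb : IsMultiPowStable I b)
    (h : IsFiniteFamily I b) : hb.familyModule.FG := by
  classical
  obtain ⟨D, hD⟩ := h
  choose g hg using fun p => IsNoetherian.noetherian (b p)
  let T : Finset (LaurentRing R s) := D.biUnion fun p => (g p).image (AddMonoidAlgebra.single p)
  have hT_mem {p : Fin s → ℤ} (hp : p ∈ D) {x : R} (hx : x ∈ g p) :
      AddMonoidAlgebra.single p x ∈ T :=
    Finset.mem_biUnion.mpr ⟨p, hp, Finset.mem_image_of_mem _ hx⟩
  refine ⟨T, le_antisymm (Submodule.span_le.mpr fun f hf => ?_) fun f hf =>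
    laurent_mem_of_single_coeff_mem fun n => ?_⟩
  · simp only [T, Finset.mem_coe, Finset.mem_biUnion, Finset.mem_image] at hf
    obtain ⟨p, _, x, hx, rfl⟩ := hf
    refine single_coeff_mem_iff.mpr ?_
    rw [← hg p]
    exact Submodule.subset_span hx
  · let N := Submodule.span (extReesRing I) (T : Set (LaurentRing R s))
    let K (n : Fin s → ℤ) : Ideal R := (N.restrictScalars R).comap (AddMonoidAlgebra.lsingle n)
    have hbK (p) (hp : p ∈ D) : b p ≤ K p := by
      rw [← hg p, Submodule.span_le]
      exact fun x hx => Submodule.subset_span (hT_mem hp hx)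
    suffices b n ≤ K n from this (hf n)
    refine (hD n).trans (iSup₂_le fun p hp => Ideal.mul_le.mpr fun x hx y hy => ?_)
    have hxy := N.smul_mem (⟨AddMonoidAlgebra.single (n - p) x, single_coeff_mem_iff.mpr hx⟩ :
      extReesRing I) (hbK p hp hy)
    rw [Subalgebra.smul_def, smul_eq_mul, AddMonoidAlgebra.lsingle_apply,
      AddMonoidAlgebra.single_mul_single, sub_add_cancel] at hxy
    exact hxy

theorem familyModule_isNoetherian [IsNoetherianRing R] (hb : IsMultiPowStable I b)
    (h : IsFiniteFamily I b) : IsNoetherian (extReesRing I) hb.familyModule := by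
  have := extReesRing_isNoetherianRing I
  exact isNoetherian_of_fg_of_noetherian _ (hb.familyModule_fg h)

end IsMultiPowStable

namespace IsFiniteFamily

theorem mono [IsNoetherianRing R] (hb : IsMultiPowStable I b) (hc : IsMultiPowStable I c)
    (h : IsFiniteFamily I c) (hbc : ∀ n, b n ≤ c n) : IsFiniteFamily I b := by
  have hle : hb.familyModule ≤ hc.familyModule := fun f hf n => hbc n (hf n)
  exact hb.isFiniteFamily_of_familyModule_fg
    (isNoetherian_submodule.mp (hc.familyModule_isNoetherian h) _ hle)

theorem shift (h : IsFiniteFamily I b) (q : Fin s → ℤ) :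
    IsFiniteFamily I fun n => b (n + q) := by
  classical
  obtain ⟨D, hD⟩ := h
  refine ⟨D.image (· - q), fun n => (hD _).trans_eq ?_⟩
  simp only [Finset.iSup_finset_image, sub_add_cancel, sub_sub_eq_add_sub]

theorem map {R' : Type*} [CommRing R'] (h : IsFiniteFamily I b) (φ : R →+* R') :
    IsFiniteFamily (fun i => (I i).map φ) fun n => (b n).map φ := by
  obtain ⟨D, hD⟩ := h
  refine ⟨D, fun n => (Ideal.map_mono (hD n)).trans_eq ?_⟩
  simp only [Ideal.map_iSup, Ideal.map_mul, multiPow_map]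

theorem exists_le_pow_mul (hb : IsMultiPowStable I b) (h : IsFiniteFamily I b) (i : Fin s)
    (k : ℕ) :
    ∃ p₀ : ℤ, ∀ n : Fin s → ℤ, p₀ ≤ n i → b n ≤ I i ^ k * b (n - Pi.single i (k : ℤ)) := by
  classical
  obtain ⟨D, hD⟩ := h
  obtain ⟨B, hB⟩ := (D.image fun p => p i).bddAbove
  refine ⟨B + k, fun n hn => (hD n).trans (iSup₂_le fun p hp => ?_)⟩
  have hpB : p i ≤ B := hB (Finset.mem_coe.mpr (Finset.mem_image_of_mem _ hp))
  have hk : (k : ℤ) ≤ (n - p) i := by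
    rw [Pi.sub_apply]
    omega
  rw [multiPow_eq_pow_mul_sub_single I hk, mul_assoc]
  refine Ideal.mul_mono_right ((hb _ _).trans_eq ?_)
  rw [show n - p - Pi.single i (k : ℤ) + p = n - Pi.single i (k : ℤ) by abel]

end IsFiniteFamily

end FiniteFamilies

/-! ### Prime avoidance and associated primes -/

section Avoidance

theorem infinite_of_infinite_residueField (R V : Type*) [CommRing R] [IsLocalRing R]
    [Infinite (ResidueField R)] [AddCommGroup V] [Module R V] [Nontrivial V] : Infinite V := by
  obtain ⟨y, hy⟩ := exists_ne (0 : V)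
  let f := LinearMap.toSpanSingleton R V y
  have hker : LinearMap.ker f ≤ maximalIdeal R := le_maximalIdeal fun htop => hy <| by
    simpa [f] using (htop.symm ▸ Submodule.mem_top : (1 : R) ∈ LinearMap.ker f)
  have : Infinite (R ⧸ LinearMap.ker f) :=
    Infinite.of_surjective (β := ResidueField R) _ (Ideal.Quotient.factor_surjective hker)
  exact Infinite.of_injective (f.range.subtype ∘ f.quotKerEquivRange)
    (f.range.injective_subtype.comp f.quotKerEquivRange.injective)

theorem exists_forall_notMem_of_infinite_residueField {R V : Type*} [CommRing R]
    [IsLocalRing R] [Infinite (ResidueField R)] [AddCommGroup V] [Module R V]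
    {W : Set (Submodule R V)} (hW : W.Finite) (htop : ⊤ ∉ W) : ∃ v, ∀ p ∈ W, v ∉ p := by
  by_contra! hcover
  obtain ⟨p, hp, hfi⟩ := Submodule.exists_finiteIndex_of_cover (p := id) (s := hW.toFinset) <|
    Set.eq_univ_iff_forall.mpr fun v => by simpa using hcover v
  have hpW : p ∈ W := hW.mem_toFinset.mp hp
  have : p.toAddSubgroup.FiniteIndex := hfi
  have : Finite (V ⧸ p) := AddSubgroup.finite_quotient_of_finiteIndex
  have : Nontrivial (V ⧸ p) :=
    Submodule.Quotient.nontrivial_iff.mpr (ne_of_mem_of_not_mem hpW htop)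
  exact (infinite_of_infinite_residueField R (V ⧸ p)).not_finite inferInstance

variable {A Q : Type*} [CommRing A] [IsNoetherianRing A] [AddCommGroup Q] [Module A Q]

theorem associatedPrimes_finite_of_locally_nilpotent (τ : A) (hτ : ∀ y : Q, ∃ k, τ ^ k • y = 0)
    (hker : (LinearMap.ker (LinearMap.lsmul A Q τ)).FG) : (associatedPrimes A Q).Finite := by
  have : Module.Finite A (LinearMap.ker (LinearMap.lsmul A Q τ)) := Module.Finite.iff_fg.mpr hker
  refine (associatedPrimes.finite A (LinearMap.ker (LinearMap.lsmul A Q τ))).subset fun P hP => ?_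
  rw [AssociatedPrimes.mem_iff, isAssociatedPrime_iff] at hP ⊢
  obtain ⟨hprime, y, hy⟩ := hP
  have hmem (r : A) : r ∈ P ↔ r • y = 0 := by
    rw [hy, Submodule.mem_colon_singleton, Submodule.mem_bot]
  -- The last nonzero `τ ^ k • y` lies in `ker τ` and still has annihilator `P`.
  obtain ⟨k, hk, hk'⟩ : ∃ k, τ ^ (k + 1) • y = 0 ∧ τ ^ k • y ≠ 0 := by
    have hy0 : τ ^ 0 • y ≠ 0 := fun h0 => hprime.ne_top <| by
      rwa [Ideal.eq_top_iff_one, hmem, ← pow_zero τ]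
    obtain ⟨k, hk, hk'⟩ := Nat.exists_not_and_succ_of_not_zero_of_exists hy0 (hτ y)
    exact ⟨k, hk', hk⟩
  refine ⟨hprime, ⟨τ ^ k • y, ?_⟩, ?_⟩
  · rw [LinearMap.mem_ker, LinearMap.lsmul_apply, smul_smul, ← pow_succ', hk]
  · ext r
    rw [Submodule.mem_colon_singleton, Submodule.mem_bot, ← Subtype.coe_inj, Submodule.coe_smul,
      Submodule.coe_zero, smul_smul, ← hmem]
    exact ⟨fun h => P.mul_mem_right _ h, fun h =>
      (hprime.mem_or_mem h).resolve_right fun h' => hk' ((hmem _).mp h')⟩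

theorem exists_pow_le_annihilator_of_associatedPrimes {Y : Submodule A Q} (hY : Y.FG) {α : A}
    {𝔞 : Ideal A} (hα : α ∈ Y.annihilator) (h : ∀ P ∈ associatedPrimes A Q, α ∈ P → 𝔞 ≤ P) :
    ∃ K, 𝔞 ^ K ≤ Y.annihilator := by
  have : Module.Finite A Y := Module.Finite.iff_fg.mpr hY
  refine Ideal.exists_pow_le_of_le_radical_of_fg ?_ (IsNoetherian.noetherian _)
  rw [← Ideal.sInf_minimalPrimes, le_sInf_iff]
  intro P hP
  have hass := Module.associatedPrimes.minimalPrimes_annihilator_subset_associatedPrimes A Y hP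
  exact h P (associatedPrimes.subset_of_injective Y.injective_subtype hass) (hP.1.2 hα)

end Avoidance

/-! ### Superficial elements -/

section Superficial

variable {R : Type*} [CommRing R] {s : ℕ}

theorem le_of_span_singleton_mul_le {a : R} (ha : a ∈ nonZeroDivisors R) {J K : Ideal R}
    (h : Ideal.span {a} * J ≤ Ideal.span {a} * K) : J ≤ K := by
  intro x hx
  obtain ⟨y, hy, hxy⟩ := Ideal.mem_span_singleton_mul.mp
    (h (Ideal.mul_mem_mul (Ideal.mem_span_singleton_self a) hx))
  exact (mul_cancel_left_mem_nonZeroDivisors ha).mp hxy ▸ hy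

variable {I : Fin s → Ideal R} {b c : (Fin s → ℤ) → Ideal R}

theorem IsFiniteFamily.colon [IsNoetherianRing R] (hb : IsMultiPowStable I b)
    (hfin : IsFiniteFamily I b) {a : R} (ha : a ∈ nonZeroDivisors R) :
    IsFiniteFamily I fun n => (b n).colon {a} := by
  have hac : IsMultiPowStable I fun n => Ideal.span {a} * (b n).colon {a} := fun n m => by
    rw [mul_left_comm]
    exact Ideal.mul_mono_right (hb.colon {a} n m)
  obtain ⟨D, hD⟩ := IsFiniteFamily.mono hac hb hfin fun n =>
    Ideal.span_singleton_mul_le_iff.mpr fun x hx => by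
      rw [mul_comm]
      exact Submodule.mem_colon_singleton.mp hx
  refine ⟨D, fun n => le_of_span_singleton_mul_le ha ((hD n).trans_eq ?_)⟩
  simp only [Ideal.mul_iSup, mul_left_comm]

/-- The `R`-linear map `Iⁿ → R'(I)`, `c ↦ c tⁿ`. -/
def extReesMonomial (I : Fin s → Ideal R) (n : Fin s → ℤ) : multiPow I n →ₗ[R] extReesRing I where
  toFun c := ⟨AddMonoidAlgebra.single n c, single_coeff_mem_iff.mpr c.2⟩
  map_add' _ _ := Subtype.ext (AddMonoidAlgebra.single_add _ _ _)
  map_smul' r _ := Subtype.ext (AddMonoidAlgebra.smul_single r _ _).symm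

theorem coeff_extReesMonomial_smul (n : Fin s → ℤ) (r : multiPow I n) (f : LaurentRing R s)
    (m : Fin s → ℤ) : (extReesMonomial I n r • f).coeff (m + n) = r * f.coeff m := by
  refine (AddMonoidAlgebra.coeff_single_mul_apply _ _ _ _).trans ?_
  rw [neg_add_eq_sub, add_sub_cancel_right]

theorem extReesMonomial_smul_mem_iff (hb : IsMultiPowStable I b) (n : Fin s → ℤ)
    (r : multiPow I n) (f : LaurentRing R s) :
    extReesMonomial I n r • f ∈ hb.familyModule ↔ ∀ m, r * f.coeff m ∈ b (m + n) := by
  simp only [← coeff_extReesMonomial_smul]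
  exact (Equiv.addRight n).forall_congr_right.symm

theorem single_pow_mem_pow_span_range (i : Fin s) {k : ℕ} {u : R}
    (hu : u ∈ multiPow I (Pi.single i 1) ^ k) :
    ∃ w ∈ Ideal.span (Set.range (extReesMonomial I (Pi.single i 1))) ^ k,
      (w : LaurentRing R s) = AddMonoidAlgebra.single (Pi.single i (k : ℤ)) u := by
  induction k generalizing u with
  | zero => exact ⟨algebraMap R _ u, by simp, by simp⟩
  | succ k ih =>
    rw [pow_succ] at hu
    induction hu using Submodule.mul_induction_on' with
    | mem_mul_mem x hx y hy =>
      obtain ⟨w, hw, hwx⟩ := ih hx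
      refine ⟨w * extReesMonomial I _ ⟨y, hy⟩, ?_, ?_⟩
      · rw [pow_succ]
        exact Ideal.mul_mem_mul hw (Ideal.subset_span ⟨_, rfl⟩)
      · rw [Subalgebra.coe_mul, hwx, Nat.cast_succ, Pi.single_add]
        exact AddMonoidAlgebra.single_mul_single _ _ _ _
    | add x _ y _ hx hy =>
      obtain ⟨w, hw, hwx⟩ := hx
      obtain ⟨v, hv, hvx⟩ := hy
      exact ⟨w + v, add_mem hw hv, by
        rw [Subalgebra.coe_add, hwx, hvx, AddMonoidAlgebra.single_add]⟩

/-- The element `(t₁ ⋯ tₛ)⁻¹` of the extended Rees ring. -/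
def extReesInv (I : Fin s → Ideal R) : extReesRing I :=
  extReesMonomial I (-1) ⟨1, by rw [multiPow_of_nonpos I (by simp)]; exact Submodule.mem_top⟩

theorem coe_extReesInv_pow (I : Fin s → Ideal R) (k : ℕ) :
    ((extReesInv I ^ k : extReesRing I) : LaurentRing R s) =
      AddMonoidAlgebra.single (-(k : Fin s → ℤ)) 1 := by
  refine (AddMonoidAlgebra.single_pow _ _ _).trans ?_
  simp

theorem exists_extReesInv_pow_smul_mem (hb : IsMultiPowStable I b) (h0 : ∀ n, n ≤ 0 → b n = ⊤)
    (f : LaurentRing R s) : ∃ k, extReesInv I ^ k • f ∈ hb.familyModule := by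
  induction f using AddMonoidAlgebra.induction_linear with
  | zero => exact ⟨0, by simp⟩
  | add f g hf hg =>
    obtain ⟨k, hk⟩ := hf
    obtain ⟨l, hl⟩ := hg
    refine ⟨k + l, ?_⟩
    rw [smul_add]
    refine add_mem ?_ ?_
    · rw [add_comm k, pow_add, mul_smul]
      exact Submodule.smul_mem _ _ hk
    · rw [pow_add, mul_smul]
      exact Submodule.smul_mem _ _ hl
  | single n c =>
    refine ⟨∑ j, (n j).toNat, ?_⟩
    have hn : -((∑ j, (n j).toNat : ℕ) : Fin s → ℤ) + n ≤ 0 := fun j => by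
      have hj : (n j).toNat ≤ ∑ j, (n j).toNat :=
        Finset.single_le_sum_of_canonicallyOrdered (f := fun j => (n j).toNat) (Finset.mem_univ j)
      simp only [Pi.add_apply, Pi.neg_apply, Pi.natCast_apply, Pi.zero_apply]
      omega
    rw [Subalgebra.smul_def, coe_extReesInv_pow, smul_eq_mul, AddMonoidAlgebra.single_mul_single]
    refine single_coeff_mem_iff.mpr ?_
    rw [h0 _ hn]
    exact Submodule.mem_top

theorem ker_extReesInv_fg [IsNoetherianRing R] (hb : IsMultiPowStable I b)
    (hfin : IsFiniteFamily I b) :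
    (LinearMap.ker (LinearMap.lsmul (extReesRing I) (LaurentRing R s ⧸ hb.familyModule)
      (extReesInv I))).FG := by
  have := extReesRing_isNoetherianRing I
  have himage : ((hb.shift (-1)).familyModule.map hb.familyModule.mkQ).FG :=
    ((hb.shift (-1)).familyModule_fg (hfin.shift (-1))).map _
  refine isNoetherian_submodule.mp (isNoetherian_of_fg_of_noetherian _ himage) _ fun y hy => ?_
  obtain ⟨f, rfl⟩ := Submodule.mkQ_surjective _ y
  rw [LinearMap.mem_ker, LinearMap.lsmul_apply, ← map_smul, Submodule.mkQ_apply,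
    Submodule.Quotient.mk_eq_zero, extReesInv, extReesMonomial_smul_mem_iff] at hy
  exact Submodule.mem_map_of_mem fun n => by simpa using hy n

theorem associatedPrimes_laurentRing_quotient_finite [IsNoetherianRing R]
    (hb : IsMultiPowStable I b) (hfin : IsFiniteFamily I b) (h0 : ∀ n, n ≤ 0 → b n = ⊤) :
    (associatedPrimes (extReesRing I) (LaurentRing R s ⧸ hb.familyModule)).Finite := by
  have := extReesRing_isNoetherianRing I
  refine associatedPrimes_finite_of_locally_nilpotent (extReesInv I) (fun y => ?_)
    (ker_extReesInv_fg hb hfin)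
  obtain ⟨f, rfl⟩ := Submodule.mkQ_surjective _ y
  obtain ⟨k, hk⟩ := exists_extReesInv_pow_smul_mem hb h0 f
  exact ⟨k, by rwa [← map_smul, Submodule.mkQ_apply, Submodule.Quotient.mk_eq_zero]⟩

theorem pow_mul_le_of_pow_span_range_le_annihilator (hb : IsMultiPowStable I b)
    (hc : IsMultiPowStable I c) {i : Fin s} {K : ℕ}
    (hK : Ideal.span (Set.range (extReesMonomial I (Pi.single i 1))) ^ K ≤
      (hc.familyModule.map hb.familyModule.mkQ).annihilator) (n : Fin s → ℤ) :
    I i ^ K * c n ≤ b (n + Pi.single i (K : ℤ)) := by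
  refine Ideal.mul_le.mpr fun u hu z hz => ?_
  rw [← multiPow_single_one I] at hu
  obtain ⟨w, hw, hwu⟩ := single_pow_mem_pow_span_range i hu
  have hzc : AddMonoidAlgebra.single n z ∈ hc.familyModule := single_coeff_mem_iff.mpr hz
  have hwz := Submodule.mem_annihilator.mp (hK hw) _ (Submodule.mem_map_of_mem hzc)
  rw [← map_smul, Submodule.mkQ_apply, Submodule.Quotient.mk_eq_zero, Subalgebra.smul_def, hwu,
    smul_eq_mul, AddMonoidAlgebra.single_mul_single, add_comm] at hwz
  exact single_coeff_mem_iff.mp hwz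

theorem exists_le_of_forall_associatedPrimes [IsNoetherianRing R] (hb : IsMultiPowStable I b)
    (hc : IsMultiPowStable I c) (hcfin : IsFiniteFamily I c) {i : Fin s}
    (a : multiPow I (Pi.single i 1)) (hac : ∀ n, ∀ x ∈ c n, a * x ∈ b (n + Pi.single i 1))
    (h : ∀ P ∈ associatedPrimes (extReesRing I) (LaurentRing R s ⧸ hb.familyModule),
      extReesMonomial I _ a ∈ P →
        Ideal.span (Set.range (extReesMonomial I (Pi.single i 1))) ≤ P) :
    ∃ p₀ : ℤ, ∀ n : Fin s → ℤ, p₀ ≤ n i → c n ≤ b n := by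
  have := extReesRing_isNoetherianRing I
  have hann : extReesMonomial I _ a ∈
      (hc.familyModule.map hb.familyModule.mkQ).annihilator := by
    rw [Submodule.mem_annihilator]
    rintro _ ⟨f, hf, rfl⟩
    rw [← map_smul, Submodule.mkQ_apply, Submodule.Quotient.mk_eq_zero,
      extReesMonomial_smul_mem_iff]
    exact fun m => hac m _ (hf m)
  obtain ⟨K, hK⟩ := exists_pow_le_annihilator_of_associatedPrimes
    ((hc.familyModule_fg hcfin).map _) hann h
  obtain ⟨p₀, hp₀⟩ := hcfin.exists_le_pow_mul hc i K
  refine ⟨p₀, fun n hn x hx => ?_⟩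
  have hle := pow_mul_le_of_pow_span_range_le_annihilator hb hc hK (n - Pi.single i (K : ℤ))
  rw [sub_add_cancel] at hle
  exact hle (hp₀ n hn hx)

theorem exists_colon_le_of_forall_associatedPrimes [IsNoetherianRing R]
    (hb : IsMultiPowStable I b) (hfin : IsFiniteFamily I b) {i : Fin s}
    (a : multiPow I (Pi.single i 1)) (ha : (a : R) ∈ nonZeroDivisors R)
    (h : ∀ P ∈ associatedPrimes (extReesRing I) (LaurentRing R s ⧸ hb.familyModule),
      extReesMonomial I _ a ∈ P →
        Ideal.span (Set.range (extReesMonomial I (Pi.single i 1))) ≤ P) :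
    ∃ p₀ : ℤ, ∀ n : Fin s → ℤ, p₀ ≤ n i → (b (n + Pi.single i 1)).colon {(a : R)} ≤ b n := by
  refine exists_le_of_forall_associatedPrimes hb ((hb.shift _).colon {(a : R)})
    ((hfin.shift _).colon (hb.shift _) ha) a (fun n x hx => ?_) h
  have hxa : x * (a : R) ∈ b (n + Pi.single i 1) := Submodule.mem_colon_singleton.mp hx
  rwa [mul_comm] at hxa

theorem mem_nonZeroDivisors_of_forall_notMem_associatedPrimes [IsNoetherianRing R] {a : R}
    (h : ∀ P ∈ associatedPrimes R R, a ∉ P) : a ∈ nonZeroDivisors R := by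
  by_contra hne
  rw [← SetLike.mem_coe, ← Set.mem_compl_iff,
    ← biUnion_associatedPrimes_eq_compl_nonZeroDivisors, Set.mem_iUnion₂] at hne
  obtain ⟨P, hP, haP⟩ := hne
  exact h P hP haP

theorem exists_superficial [IsNoetherianRing R] [IsLocalRing R] [Infinite (ResidueField R)]
    (hb : IsMultiPowStable I b) (hfin : IsFiniteFamily I b) (h0 : ∀ n, n ≤ 0 → b n = ⊤)
    (i : Fin s) (hreg : ∀ P ∈ associatedPrimes R R, ¬ I i ≤ P) :
    ∃ a ∈ I i, a ∈ nonZeroDivisors R ∧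
      ∃ p₀ : ℤ, ∀ n : Fin s → ℤ, p₀ ≤ n i → (b (n + Pi.single i 1)).colon {a} ≤ b n := by
  let 𝔞 := Ideal.span (Set.range (extReesMonomial I (Pi.single i 1)))
  let W₁ : Set (Submodule R (multiPow I (Pi.single i 1))) :=
    (fun P : Ideal (extReesRing I) => (P.restrictScalars R).comap (extReesMonomial I _)) ''
      {P ∈ associatedPrimes (extReesRing I) (LaurentRing R s ⧸ hb.familyModule) | ¬ 𝔞 ≤ P}
  let W₂ : Set (Submodule R (multiPow I (Pi.single i 1))) :=
    (fun P : Ideal R => Submodule.comap (multiPow I (Pi.single i 1)).subtype P) ''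
      associatedPrimes R R
  have hW : (W₁ ∪ W₂).Finite :=
    (((associatedPrimes_laurentRing_quotient_finite hb hfin h0).sep _).image _).union
      ((associatedPrimes.finite R R).image _)
  have htop : ⊤ ∉ W₁ ∪ W₂ := by
    rintro (⟨P, ⟨_, hP⟩, hPtop⟩ | ⟨P, hP, hPtop⟩)
    · refine hP (Ideal.span_le.mpr ?_)
      rintro _ ⟨c, rfl⟩
      exact hPtop.ge (Submodule.mem_top (x := c))
    · refine hreg P hP fun c hc => ?_
      rw [← multiPow_single_one I] at hc
      exact hPtop.ge (Submodule.mem_top (x := ⟨c, hc⟩))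
  obtain ⟨a, ha⟩ := exists_forall_notMem_of_infinite_residueField hW htop
  have ha_reg : (a : R) ∈ nonZeroDivisors R :=
    mem_nonZeroDivisors_of_forall_notMem_associatedPrimes fun P hP haP =>
      ha _ (Or.inr ⟨P, hP, rfl⟩) haP
  refine ⟨a, by simpa only [multiPow_single_one] using a.2, ha_reg,
    exists_colon_le_of_forall_associatedPrimes hb hfin a ha_reg fun P hP haP => ?_⟩
  by_contra hle
  exact ha _ (Or.inl ⟨P, ⟨hP, hle⟩, rfl⟩) haP

end Superficial

/-! ### Reductions in local rings -/

section LocalRing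

open RingTheory.Sequence

variable {R : Type*} [CommRing R]

theorem isSMulRegular_iff_mem_nonZeroDivisors {x : R} :
    IsSMulRegular R x ↔ x ∈ nonZeroDivisors R := by
  rw [isSMulRegular_iff_right_eq_zero_of_smul, mem_nonZeroDivisors_iff_right]
  simp only [smul_eq_mul, mul_comm]

theorem isWeaklyRegular_pair_iff {a c : R} :
    IsWeaklyRegular R [a, c] ↔ a ∈ nonZeroDivisors R ∧ ∀ u, a ∣ c * u → a ∣ u := by
  rw [isWeaklyRegular_cons_iff, isWeaklyRegular_singleton_iff,
    isSMulRegular_iff_mem_nonZeroDivisors, isSMulRegular_quotient_iff_mem_of_smul_mem]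
  simp only [Submodule.mem_smul_pointwise_iff_exists, Submodule.mem_top, true_and, smul_eq_mul,
    dvd_def, eq_comm]

theorem dvd_of_dvd_mul_of_isWeaklyRegular_pair {x y a z : R} (hxy : IsWeaklyRegular R [x, y])
    (ha : a ∈ nonZeroDivisors R) (hx : a ∣ x * z) (hy : a ∣ y * z) : a ∣ z := by
  obtain ⟨hxreg, hyreg⟩ := isWeaklyRegular_pair_iff.mp hxy
  obtain ⟨w, hw⟩ := hx
  obtain ⟨v, hv⟩ := hy
  have hywv : y * w = x * v := by
    rw [← mul_cancel_left_mem_nonZeroDivisors ha]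
    linear_combination x * hv - y * hw
  obtain ⟨t, rfl⟩ := hyreg w ⟨v, hywv⟩
  refine ⟨t, ?_⟩
  rw [← mul_cancel_left_mem_nonZeroDivisors hxreg]
  linear_combination hw

theorem map_mk_le_map_mk_iff {J B C : Ideal R} :
    B.map (Ideal.Quotient.mk J) ≤ C.map (Ideal.Quotient.mk J) ↔ B ≤ J ⊔ C := by
  rw [Ideal.map_le_iff_le_comap, Ideal.comap_map_quotientMk]

theorem le_span_singleton_mul_colon_sup {B C : Ideal R} {a : R} (hCB : C ≤ B)
    (hBC : B ≤ Ideal.span {a} ⊔ C) : B ≤ Ideal.span {a} * B.colon {a} ⊔ C := by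
  intro z hz
  obtain ⟨_, hav, w, hw, rfl⟩ := Submodule.mem_sup.mp (hBC hz)
  obtain ⟨v, rfl⟩ := Ideal.mem_span_singleton.mp hav
  refine Submodule.add_mem_sup (Ideal.mul_mem_mul (Ideal.mem_span_singleton_self a) ?_) hw
  rw [Submodule.mem_colon_singleton, smul_eq_mul, mul_comm]
  exact (Ideal.add_mem_iff_left B (hCB hw)).mp hz

variable [IsLocalRing R]

theorem IsCohenMacaulayLocal.exists_nonZeroDivisor {d : ℕ} (h : IsCohenMacaulayLocal R)
    (hd : ringKrullDim R = d) (hd1 : 1 ≤ d) : ∃ x ∈ maximalIdeal R, x ∈ nonZeroDivisors R := by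
  obtain ⟨rs, hmem, hreg, hlen⟩ := h
  have hlen : rs.length = d := by exact_mod_cast hlen.trans hd
  obtain ⟨x, rs, rfl⟩ := List.exists_cons_of_length_pos (hlen ▸ hd1)
  have hx := ((isWeaklyRegular_cons_iff R x rs).mp hreg.toIsWeaklyRegular).1
  exact ⟨x, hmem x List.mem_cons_self, isSMulRegular_iff_mem_nonZeroDivisors.mp hx⟩

theorem IsCohenMacaulayLocal.exists_isWeaklyRegular_pair (h : IsCohenMacaulayLocal R)
    (hd : ringKrullDim R = 2) :
    ∃ x ∈ maximalIdeal R, ∃ y ∈ maximalIdeal R, IsWeaklyRegular R [x, y] := by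
  obtain ⟨rs, hmem, hreg, hlen⟩ := h
  have hlen : rs.length = 2 := by exact_mod_cast hlen.trans hd
  obtain ⟨x, y, rfl⟩ := List.length_eq_two.mp hlen
  exact ⟨x, hmem x (by simp), y, hmem y (by simp), hreg.toIsWeaklyRegular⟩

theorem isLocalRing_quotient_span_singleton {a : R} (ha : a ∈ maximalIdeal R) :
    IsLocalRing (R ⧸ Ideal.span {a}) := by
  have : Nontrivial (R ⧸ Ideal.span {a}) := by
    rwa [Ideal.Quotient.nontrivial_iff, ne_eq, Ideal.span_singleton_eq_top]
  exact IsLocalRing.of_surjective' _ Ideal.Quotient.mk_surjective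

theorem maximalIdeal_eq_map_of_surjective {S : Type*} [CommRing S] [IsLocalRing S] {φ : R →+* S}
    (hφ : Function.Surjective φ) : maximalIdeal S = (maximalIdeal R).map φ := by
  have := IsLocalHom.of_surjective φ hφ
  rw [← maximalIdeal_comap φ, Ideal.map_comap_of_surjective φ hφ]

theorem infinite_residueField_of_surjective {S : Type*} [CommRing S] [IsLocalRing S]
    [Infinite (ResidueField R)] {φ : R →+* S} (hφ : Function.Surjective φ) :
    Infinite (ResidueField S) :=
  have := IsLocalHom.of_surjective φ hφ
  Infinite.of_injective (ResidueField.map φ) (ResidueField.map φ).injective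

theorem not_le_of_mem_associatedPrimes (hdepth : maximalIdeal R ∉ associatedPrimes R R)
    {J : Ideal R} (hJ : ∃ k, maximalIdeal R ^ k ≤ J) {P : Ideal R}
    (hP : P ∈ associatedPrimes R R) : ¬ J ≤ P := by
  intro hle
  obtain ⟨k, hk⟩ := hJ
  have hprime : P.IsPrime := hP.isPrime
  have hmP : maximalIdeal R ≤ P := hprime.le_of_pow_le (hk.trans hle)
  exact hdepth (le_antisymm (le_maximalIdeal hprime.ne_top) hmP ▸ hP)

variable [IsNoetherianRing R]

theorem maximalIdeal_notMem_associatedPrimes {x : R} (hx : x ∈ maximalIdeal R)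
    (hreg : x ∈ nonZeroDivisors R) : maximalIdeal R ∉ associatedPrimes R R := by
  intro hP
  have hmem : x ∈ ⋃ p ∈ associatedPrimes R R, (p : Set R) := Set.mem_biUnion hP hx
  rw [biUnion_associatedPrimes_eq_compl_nonZeroDivisors] at hmem
  exact hmem hreg

theorem maximalIdeal_notMem_associatedPrimes_quotient {x y a : R} (hx : x ∈ maximalIdeal R)
    (hy : y ∈ maximalIdeal R) (hxy : IsWeaklyRegular R [x, y]) (ha : a ∈ nonZeroDivisors R)
    [IsLocalRing (R ⧸ Ideal.span {a})] :
    maximalIdeal (R ⧸ Ideal.span {a}) ∉ associatedPrimes _ (R ⧸ Ideal.span {a}) := by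
  rw [AssociatedPrimes.mem_iff, isAssociatedPrime_iff]
  rintro ⟨hprime, z, hz⟩
  obtain ⟨z, rfl⟩ := Ideal.Quotient.mk_surjective z
  have dvd_iff (t : R) : a ∣ t * z ↔
      Ideal.Quotient.mk (Ideal.span {a}) t ∈ maximalIdeal (R ⧸ Ideal.span {a}) := by
    rw [hz, Submodule.mem_colon_singleton, Submodule.mem_bot, smul_eq_mul, ← map_mul,
      Ideal.Quotient.eq_zero_iff_mem, Ideal.mem_span_singleton]
  have dvd_mul {t : R} (ht : t ∈ maximalIdeal R) : a ∣ t * z := by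
    rw [dvd_iff, maximalIdeal_eq_map_of_surjective Ideal.Quotient.mk_surjective]
    exact Ideal.mem_map_of_mem _ ht
  refine hprime.ne_top ((Ideal.eq_top_iff_one _).mpr ?_)
  rw [← map_one (Ideal.Quotient.mk _), ← dvd_iff, one_mul]
  exact dvd_of_dvd_mul_of_isWeaklyRegular_pair hxy ha (dvd_mul hx) (dvd_mul hy)

theorem ringKrullDim_quotient_span_singleton {a : R} (ha : a ∈ nonZeroDivisors R)
    (ham : a ∈ maximalIdeal R) {D : WithBot ℕ∞} (hdim : ringKrullDim R = D + 1) :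
    ringKrullDim (R ⧸ Ideal.span {a}) = D := by
  rw [← ringKrullDim_quotient_span_singleton_succ_eq_ringKrullDim_of_mem_nonZeroDivisors ha ham]
    at hdim
  exact ENat.WithBot.add_one_cancel.mp hdim

theorem exists_maximalIdeal_pow_le_span_singleton (hdim : ringKrullDim R = 1) {a : R}
    (ha : a ∈ nonZeroDivisors R) (ham : a ∈ maximalIdeal R) :
    ∃ k, maximalIdeal R ^ k ≤ Ideal.span {a} := by
  have := isLocalRing_quotient_span_singleton ham
  have hdim' : ringKrullDim (R ⧸ Ideal.span {a}) = 0 :=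
    ringKrullDim_quotient_span_singleton ha ham (hdim.trans (zero_add 1).symm)
  have : Ring.KrullDimLE 0 (R ⧸ Ideal.span {a}) := Ring.krullDimLE_iff.mpr hdim'.le
  obtain ⟨k, hk⟩ := (isArtinianRing_iff_isNilpotent_maximalIdeal (R ⧸ Ideal.span {a})).mp
    (isArtinianRing_iff_krullDimLE_zero.mpr this)
  refine ⟨k, ?_⟩
  rw [← Ideal.mk_ker (I := Ideal.span {a}), ← Ideal.map_eq_bot_iff_le_ker, Ideal.map_pow,
    ← maximalIdeal_eq_map_of_surjective Ideal.Quotient.mk_surjective, hk, Ideal.zero_eq_bot]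

variable [Infinite (ResidueField R)] {s : ℕ} {I : Fin s → Ideal R} {b : (Fin s → ℤ) → Ideal R}

theorem exists_principal_reduction (hdim : ringKrullDim R = 1)
    (hdepth : maximalIdeal R ∉ associatedPrimes R R) (hIm : ∀ i, I i ≤ maximalIdeal R)
    (hmI : ∀ i, ∃ k, maximalIdeal R ^ k ≤ I i) (hb : IsMultiPowStable I b)
    (hfin : IsFiniteFamily I b) (h0 : ∀ n, n ≤ 0 → b n = ⊤) (i : Fin s) :
    ∃ a ∈ I i, a ∈ nonZeroDivisors R ∧ (∃ k, maximalIdeal R ^ k ≤ Ideal.span {a}) ∧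
      ∃ p₀ : ℤ, ∀ n : Fin s → ℤ, p₀ ≤ n i → b (n + Pi.single i 1) ≤ Ideal.span {a} * b n := by
  obtain ⟨a, haI, ha, p, hp⟩ := exists_superficial hb hfin h0 i
    fun _ => not_le_of_mem_associatedPrimes hdepth (hmI i)
  obtain ⟨k, hk⟩ := exists_maximalIdeal_pow_le_span_singleton hdim ha (hIm i haI)
  obtain ⟨q, hq⟩ := hfin.exists_le_pow_mul hb i k
  refine ⟨a, haI, ha, ⟨k, hk⟩, max p q, fun n hn => ?_⟩
  have hle : b (n + Pi.single i 1) ≤ Ideal.span {a} := by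
    have hqn : q ≤ (n + Pi.single i 1 : Fin s → ℤ) i := by
      rw [Pi.add_apply, Pi.single_eq_same]
      omega
    exact (hq _ hqn).trans (Ideal.mul_le_left.trans ((Ideal.pow_right_mono (hIm i) k).trans hk))
  have hcolon := le_span_singleton_mul_colon_sup bot_le (hle.trans le_sup_left)
  rw [sup_bot_eq] at hcolon
  exact hcolon.trans (Ideal.mul_mono_right (hp n ((le_max_left p q).trans hn)))

theorem exists_principal_reduction_mod {a : R} (ha : a ∈ nonZeroDivisors R)
    (ham : a ∈ maximalIdeal R) (hdim : ringKrullDim R = 2) (hCM : IsCohenMacaulayLocal R)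
    (hIm : ∀ i, I i ≤ maximalIdeal R) (hmI : ∀ i, ∃ k, maximalIdeal R ^ k ≤ I i)
    (hb : IsMultiPowStable I b) (hfin : IsFiniteFamily I b) (h0 : ∀ n, n ≤ 0 → b n = ⊤)
    (j : Fin s) :
    ∃ c ∈ I j, IsWeaklyRegular R [a, c] ∧
      (∃ k, maximalIdeal R ^ k ≤ Ideal.span {a} ⊔ Ideal.span {c}) ∧
      ∃ p₀ : ℤ, ∀ n : Fin s → ℤ, p₀ ≤ n j →
        b (n + Pi.single j 1) ≤ Ideal.span {a} ⊔ Ideal.span {c} * b n := by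
  obtain ⟨x, hx, y, hy, hxy⟩ := hCM.exists_isWeaklyRegular_pair hdim
  have := isLocalRing_quotient_span_singleton ham
  set π := Ideal.Quotient.mk (Ideal.span {a})
  have hπ : Function.Surjective π := Ideal.Quotient.mk_surjective
  have := infinite_residueField_of_surjective hπ
  have hmax := maximalIdeal_eq_map_of_surjective hπ
  obtain ⟨c', hcI', hc', ⟨k, hk⟩, p, hp⟩ := exists_principal_reduction (i := j)
    (ringKrullDim_quotient_span_singleton ha ham (hdim.trans one_add_one_eq_two.symm))
    (maximalIdeal_notMem_associatedPrimes_quotient hx hy hxy ha)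
    (fun l => hmax ▸ Ideal.map_mono (hIm l))
    (fun l => (hmI l).imp fun k hk => by
      rw [hmax, ← Ideal.map_pow]
      exact Ideal.map_mono hk)
    (hb.map π) (hfin.map π) (fun n hn => by rw [h0 n hn, Ideal.map_top])
  obtain ⟨c, hcI, rfl⟩ := (Ideal.mem_map_iff_of_surjective π hπ).mp hcI'
  rw [← Set.image_singleton, ← Ideal.map_span] at hk hp
  refine ⟨c, hcI, isWeaklyRegular_pair_iff.mpr ⟨ha, fun u hu => ?_⟩, ⟨k, ?_⟩, p, fun n hn => ?_⟩
  · rwa [← Ideal.mem_span_singleton, ← Ideal.Quotient.eq_zero_iff_mem, map_mul,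
      mul_left_mem_nonZeroDivisors_eq_zero_iff hc', Ideal.Quotient.eq_zero_iff_mem,
      Ideal.mem_span_singleton] at hu
  · rwa [hmax, ← Ideal.map_pow, map_mk_le_map_mk_iff] at hk
  · have hpn := hp n hn
    rwa [← Ideal.map_mul, map_mk_le_map_mk_iff] at hpn

theorem exists_joint_reduction (hdim : ringKrullDim R = 2) (hCM : IsCohenMacaulayLocal R)
    (hIm : ∀ i, I i ≤ maximalIdeal R) (hmI : ∀ i, ∃ k, maximalIdeal R ^ k ≤ I i)
    (hb : IsMultiPowStable I b) (hfin : IsFiniteFamily I b) (h0 : ∀ n, n ≤ 0 → b n = ⊤)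
    (i j : Fin s) :
    ∃ a ∈ I i, ∃ c ∈ I j, IsWeaklyRegular R [a, c] ∧
      (∃ k, maximalIdeal R ^ k ≤ Ideal.span {a} ⊔ Ideal.span {c}) ∧
      ∃ p₀ : ℤ, (∀ n : Fin s → ℤ, p₀ ≤ n i → (b (n + Pi.single i 1)).colon {a} ≤ b n) ∧
        ∀ n : Fin s → ℤ, p₀ ≤ n i → p₀ ≤ n j → b (n + Pi.single i 1 + Pi.single j 1) ≤
          Ideal.span {a} * b (n + Pi.single j 1) ⊔ Ideal.span {c} * b (n + Pi.single i 1) := by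
  obtain ⟨x, hx, hxreg⟩ := hCM.exists_nonZeroDivisor (d := 2) hdim one_le_two
  obtain ⟨a, haI, ha, p, hp⟩ := exists_superficial hb hfin h0 i fun _ =>
    not_le_of_mem_associatedPrimes (maximalIdeal_notMem_associatedPrimes hx hxreg) (hmI i)
  obtain ⟨c, hcI, hac, hpow, q, hq⟩ :=
    exists_principal_reduction_mod ha (hIm i haI) hdim hCM hIm hmI hb hfin h0 j
  refine ⟨a, haI, c, hcI, hac, hpow, max p q, fun n hn => hp n ((le_max_left p q).trans hn),
    fun n hni hnj => ?_⟩
  have single_nonneg (k l : Fin s) : (0 : ℤ) ≤ (Pi.single k 1 : Fin s → ℤ) l :=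
    (Pi.single_nonneg.mpr zero_le_one : (0 : Fin s → ℤ) ≤ Pi.single k 1) l
  have hqn : q ≤ (n + Pi.single i 1 : Fin s → ℤ) j := by
    rw [Pi.add_apply]
    linarith [le_max_right p q, single_nonneg i j]
  have hpn : p ≤ (n + Pi.single j 1 : Fin s → ℤ) i := by
    rw [Pi.add_apply]
    linarith [le_max_left p q, single_nonneg j i]
  have hcb : Ideal.span {c} * b (n + Pi.single i 1) ≤ b (n + Pi.single i 1 + Pi.single j 1) := by
    rw [Ideal.span_singleton_mul_le_iff]
    exact fun z hz => hb.mul_mem_add_single hcI hz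
  have hcolon := hp _ hpn
  rw [add_right_comm] at hcolon
  exact (le_span_singleton_mul_colon_sup hcb (hq _ hqn)).trans
    (sup_le_sup_right (Ideal.mul_mono_right hcolon) _)

end LocalRing

/-! ### Lengths -/

section Length

variable {R : Type*} [CommRing R]

theorem length_quotient_map_add_length_quotient_comap {L M N : Type*} [AddCommGroup L] [Module R L]
    [AddCommGroup M] [Module R M] [AddCommGroup N] [Module R N] {g : L →ₗ[R] M} {f : M →ₗ[R] N}
    (hgf : Function.Exact g f) (P : Submodule R M) :
    Module.length R (N ⧸ P.map f) + Module.length R (L ⧸ P.comap g) =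
      Module.length R (N ⧸ LinearMap.range f) + Module.length R (M ⧸ P) := by
  let g' : (L ⧸ P.comap g) →ₗ[R] M ⧸ P := Submodule.mapQ _ _ g le_rfl
  let f' : (M ⧸ P) →ₗ[R] N ⧸ P.map f := Submodule.mapQ _ _ f (Submodule.le_comap_map f P)
  let π : (N ⧸ P.map f) →ₗ[R] N ⧸ LinearMap.range f := Submodule.factor LinearMap.map_le_range
  have hg' : Function.Injective g' := by
    rw [← LinearMap.ker_eq_bot, Submodule.ker_mapQ, Submodule.mkQ_map_self]
  have hgf' : Function.Exact g' f' := (hgf.exact_mapQ_iff _ _).mpr inf_le_right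
  have hf'π : Function.Exact f' π := by
    rw [LinearMap.exact_iff]
    simp only [f', π, Submodule.factor, Submodule.ker_mapQ, Submodule.range_mapQ,
      Submodule.comap_id]
  have hπ : Function.Surjective π := Submodule.factor_surjective _
  have hM := Module.length_eq_add_of_exact g' f'.rangeRestrict hg' f'.surjective_rangeRestrict
    (by rwa [LinearMap.exact_iff, LinearMap.ker_rangeRestrict, ← LinearMap.exact_iff])
  have hN := Module.length_eq_add_of_exact (LinearMap.range f').subtype π
    (Submodule.subtype_injective _) hπ
    (by rwa [LinearMap.exact_iff, Submodule.range_subtype, ← LinearMap.exact_iff])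
  rw [hM, hN]
  abel

theorem map_mulLeft_eq_span_singleton_mul (a : R) (J : Ideal R) :
    Submodule.map (LinearMap.mulLeft R a) J = Ideal.span {a} * J := by
  ext z
  simp only [Submodule.mem_map, LinearMap.mulLeft_apply, Ideal.mem_span_singleton_mul]

theorem length_quotient_span_singleton_mul {a : R} (ha : a ∈ nonZeroDivisors R) (J : Ideal R) :
    Module.length R (R ⧸ (Ideal.span {a} * J)) =
      Module.length R (R ⧸ Ideal.span {a}) + Module.length R (R ⧸ J) := by
  have hexact : Function.Exact (0 : R →ₗ[R] R) (LinearMap.mulLeft R a) := by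
    rw [LinearMap.exact_zero_iff_injective]
    exact fun u v => (mul_cancel_left_mem_nonZeroDivisors ha).mp
  have hlen := length_quotient_map_add_length_quotient_comap hexact J
  have hzero : Module.length R (R ⧸ Submodule.comap (0 : R →ₗ[R] R) J) = 0 := by
    rw [Submodule.comap_zero, Module.length_eq_zero]
  rwa [LinearMap.range_eq_map, map_mulLeft_eq_span_singleton_mul,
    map_mulLeft_eq_span_singleton_mul, Ideal.mul_top, hzero, add_zero] at hlen

theorem exact_of_isWeaklyRegular_pair {a c : R}
    (hac : RingTheory.Sequence.IsWeaklyRegular R [a, c]) :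
    Function.Exact ((LinearMap.mulLeft R c).prod (-LinearMap.mulLeft R a))
      ((LinearMap.mulLeft R a).coprod (LinearMap.mulLeft R c)) := by
  obtain ⟨ha, hreg⟩ := isWeaklyRegular_pair_iff.mp hac
  rintro ⟨u, v⟩
  change a * u + c * v = 0 ↔ ∃ w, (c * w, -(a * w)) = (u, v)
  simp only [Prod.mk.injEq]
  constructor
  · intro huv
    obtain ⟨w, rfl⟩ := hreg v ⟨-u, by linear_combination huv⟩
    refine ⟨-w, ?_, by ring⟩
    rw [← mul_cancel_left_mem_nonZeroDivisors ha]
    linear_combination -huv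
  · rintro ⟨w, rfl, rfl⟩
    ring

theorem length_quotient_span_mul_sup_span_mul {a c : R}
    (hac : RingTheory.Sequence.IsWeaklyRegular R [a, c]) (J K : Ideal R) :
    Module.length R (R ⧸ (Ideal.span {a} * J ⊔ Ideal.span {c} * K)) +
        Module.length R (R ⧸ (J.colon {c} ⊓ K.colon {a} : Ideal R)) =
      Module.length R (R ⧸ (Ideal.span {a} ⊔ Ideal.span {c})) +
        (Module.length R (R ⧸ J) + Module.length R (R ⧸ K)) := by
  set f := (LinearMap.mulLeft R a).coprod (LinearMap.mulLeft R c)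
  set g := (LinearMap.mulLeft R c).prod (-LinearMap.mulLeft R a)
  have hmap (J K : Ideal R) :
      (Submodule.prod J K).map f = Ideal.span {a} * J ⊔ Ideal.span {c} * K := by
    rw [LinearMap.map_coprod_prod, map_mulLeft_eq_span_singleton_mul,
      map_mulLeft_eq_span_singleton_mul]
  have hrange : LinearMap.range f = Ideal.span {a} ⊔ Ideal.span {c} := by
    rw [LinearMap.range_eq_map, ← Submodule.prod_top, hmap, Ideal.mul_top, Ideal.mul_top]
  have hcomap : (Submodule.prod J K).comap g = J.colon {c} ⊓ K.colon {a} := by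
    ext w
    simp [g, Submodule.mem_colon_singleton, mul_comm]
  have hprod : Module.length R ((R × R) ⧸ Submodule.prod J K) =
      Module.length R (R ⧸ J) + Module.length R (R ⧸ K) := by
    have hker : LinearMap.ker (J.mkQ.prodMap K.mkQ) = Submodule.prod J K := by
      rw [LinearMap.ker_prodMap, Submodule.ker_mkQ, Submodule.ker_mkQ]
    rw [← hker, ((J.mkQ.prodMap K.mkQ).quotKerEquivOfSurjective
      (J.mkQ_surjective.prodMap K.mkQ_surjective)).length_eq, Module.length_prod]
  have hlen := length_quotient_map_add_length_quotient_comap (exact_of_isWeaklyRegular_pair hac)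
    (Submodule.prod J K)
  rwa [hmap, hrange, hcomap, hprod] at hlen

theorem length_quotient_anti {J K : Ideal R} (h : J ≤ K) :
    Module.length R (R ⧸ K) ≤ Module.length R (R ⧸ J) :=
  Module.length_le_of_surjective (Submodule.factor h) (Submodule.factor_surjective h)

theorem length_quotient_ne_top [IsLocalRing R] [IsNoetherianRing R] {J : Ideal R}
    (h : ∃ k, maximalIdeal R ^ k ≤ J) : Module.length R (R ⧸ J) ≠ ⊤ := by
  obtain ⟨k, hk⟩ := h
  rcases eq_or_ne J ⊤ with rfl | hJ
  · rw [Module.length_eq_zero]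
    exact ENat.zero_ne_top
  have := Ideal.Quotient.nontrivial_iff.mpr hJ
  have hJs : Function.Surjective (Ideal.Quotient.mk J) := Ideal.Quotient.mk_surjective
  have := IsLocalRing.of_surjective' _ hJs
  have : IsArtinianRing (R ⧸ J) := by
    rw [isArtinianRing_iff_isNilpotent_maximalIdeal]
    refine ⟨k, ?_⟩
    rwa [maximalIdeal_eq_map_of_surjective hJs, ← Ideal.map_pow, Ideal.zero_eq_bot,
      Ideal.map_eq_bot_iff_le_ker, Ideal.mk_ker]
  rw [Module.length_eq_of_surjective (R := R ⧸ J) hJs]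
  exact Module.length_ne_top

end Length

/-! ### Numerical polynomials -/

section NumericalPolynomials

open Filter
open scoped fwdDiff

variable {s : ℕ}

/-- The exponents `α` of total degree `|α| ≤ d`, which index the terms of a numerical polynomial of
degree `d`. -/
def degreeLE (s d : ℕ) : Finset (Fin s → ℕ) :=
  (Finset.Iic (fun _ : Fin s => d)).filter (fun α => ∑ i, α i ≤ d)

theorem mem_degreeLE {d : ℕ} {α : Fin s → ℕ} : α ∈ degreeLE s d ↔ ∑ i, α i ≤ d := by
  rw [degreeLE, Finset.mem_filter, Finset.mem_Iic, and_iff_right_iff_imp]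
  exact fun h i => (Finset.single_le_sum_of_canonicallyOrdered (Finset.mem_univ i)).trans h

theorem sum_add_single (α : Fin s → ℕ) (i : Fin s) :
    ∑ j, (α + Pi.single i 1 : Fin s → ℕ) j = ∑ j, α j + 1 := by
  simp [Finset.sum_add_distrib]

theorem exists_eq_add_single {α : Fin s → ℕ} {i : Fin s} (h : α i ≠ 0) :
    ∃ β : Fin s → ℕ, α = β + Pi.single i 1 := by
  refine ⟨α - Pi.single i 1, (tsub_add_cancel_of_le fun j => ?_).symm⟩
  rcases eq_or_ne j i with rfl | hj
  · rw [Pi.single_eq_same]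
    exact Nat.one_le_iff_ne_zero.mpr h
  · rw [Pi.single_eq_of_ne hj]
    exact Nat.zero_le _

theorem exists_eq_add_single_of_ne_zero {d : ℕ} {α : Fin s → ℕ} (hα : α ≠ 0)
    (hd : ∑ i, α i ≤ d) :
    ∃ (β : Fin s → ℕ) (i : Fin s), α = β + Pi.single i 1 ∧ ∑ j, β j + 1 ≤ d := by
  obtain ⟨i, hi⟩ := Function.ne_iff.mp hα
  obtain ⟨β, rfl⟩ := exists_eq_add_single hi
  exact ⟨β, i, rfl, (sum_add_single β i).symm.le.trans hd⟩

/-- The product `∏ᵢ binom(nᵢ + αᵢ - 1, αᵢ)` in the term of exponent `α` of a numerical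
polynomial. -/
def multiBinom (n : Fin s → ℤ) (α : Fin s → ℕ) : ℤ :=
  ∏ i, Ring.choose (n i + α i - 1) (α i)

theorem numericalPoly_eq (d : ℕ) (e : (Fin s → ℕ) → ℤ) (n : Fin s → ℤ) :
    numericalPoly d e n =
      ∑ α ∈ degreeLE s d, (-1) ^ (d - ∑ i, α i) * e α * multiBinom n α := rfl

theorem multiBinom_zero_right (n : Fin s → ℤ) : multiBinom n 0 = 1 := by
  simp [multiBinom]

theorem multiBinom_zero_left {α : Fin s → ℕ} (hα : α ≠ 0) : multiBinom 0 α = 0 := by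
  obtain ⟨i, hi⟩ := Function.ne_iff.mp hα
  obtain ⟨k, hk⟩ := Nat.exists_eq_succ_of_ne_zero hi
  refine Finset.prod_eq_zero (Finset.mem_univ i) ?_
  rw [hk, Pi.zero_apply, zero_add, Nat.cast_succ, add_sub_cancel_right, Ring.choose_natCast,
    Nat.choose_succ_self, Nat.cast_zero]

theorem fwdDiff_multiBinom_of_eq_zero {α : Fin s → ℕ} {i : Fin s} (h : α i = 0) (n : Fin s → ℤ) :
    Δ_[Pi.single i 1] (multiBinom · α) n = 0 := by
  refine sub_eq_zero.mpr (Finset.prod_congr rfl fun j _ => ?_)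
  rcases eq_or_ne j i with rfl | hj
  · rw [h, Ring.choose_zero_right, Ring.choose_zero_right]
  · rw [Pi.add_apply, Pi.single_eq_of_ne hj, add_zero]

theorem fwdDiff_multiBinom_add_single (α : Fin s → ℕ) (i : Fin s) (n : Fin s → ℤ) :
    Δ_[Pi.single i 1] (multiBinom · (α + Pi.single i 1)) n =
      multiBinom (n + Pi.single i 1) α := by
  have hprod {m : Fin s → ℤ} {β : Fin s → ℕ} (hm : ∀ j ≠ i, m j = n j)
      (hβ : ∀ j ≠ i, β j = α j) : multiBinom m β = Ring.choose (m i + β i - 1) (β i) *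
        ∏ j ∈ Finset.univ.erase i, Ring.choose (n j + α j - 1) (α j) := by
    rw [multiBinom, ← Finset.mul_prod_erase _ _ (Finset.mem_univ i)]
    congr 1
    refine Finset.prod_congr rfl fun j hj => ?_
    rw [hm j (Finset.ne_of_mem_erase hj), hβ j (Finset.ne_of_mem_erase hj)]
  have hn : ∀ j ≠ i, (n + Pi.single i 1 : Fin s → ℤ) j = n j := fun j hj => by simp [hj]
  have hα : ∀ j ≠ i, (α + Pi.single i 1 : Fin s → ℕ) j = α j := fun j hj => by simp [hj]
  have pascal := Ring.choose_succ_succ (n i + α i) (α i)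
  rw [fwdDiff, hprod hn hα, hprod (fun _ _ => rfl) hα, hprod hn (fun _ _ => rfl), ← sub_mul]
  simp only [Pi.add_apply, Pi.single_eq_same, Nat.cast_add, Nat.cast_one]
  rw [← add_assoc, add_right_comm (n i) 1, add_sub_cancel_right, add_sub_cancel_right, ← add_assoc,
    add_sub_cancel_right, pascal, add_sub_cancel_right]

theorem fwdDiff_numericalPoly (d : ℕ) (e : (Fin s → ℕ) → ℤ) (i : Fin s) (n : Fin s → ℤ) :
    Δ_[Pi.single i 1] (numericalPoly (d + 1) e) n =
      numericalPoly d (fun α => e (α + Pi.single i 1)) (n + Pi.single i 1) := by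
  have hterm : Δ_[Pi.single i 1] (numericalPoly (d + 1) e) n = ∑ α ∈ degreeLE s (d + 1),
      (-1) ^ (d + 1 - ∑ j, α j) * e α * Δ_[Pi.single i 1] (multiBinom · α) n := by
    simp only [fwdDiff, numericalPoly_eq, mul_sub, Finset.sum_sub_distrib]
  rw [hterm, numericalPoly_eq]
  symm
  refine Finset.sum_of_injOn (· + Pi.single i 1) (add_left_injective _).injOn ?_ ?_ ?_
  · intro α hα
    rw [Finset.mem_coe, mem_degreeLE] at hα ⊢
    rw [sum_add_single]
    exact Nat.succ_le_succ hα
  · intro α hα hα'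
    suffices hαi : α i = 0 by rw [fwdDiff_multiBinom_of_eq_zero hαi, mul_zero]
    by_contra hαi
    obtain ⟨β, rfl⟩ := exists_eq_add_single hαi
    rw [mem_degreeLE, sum_add_single] at hα
    exact hα' ⟨β, mem_degreeLE.mpr (Nat.le_of_succ_le_succ hα), rfl⟩
  · intro α _
    rw [fwdDiff_multiBinom_add_single, sum_add_single, Nat.add_sub_add_right]

theorem numericalPoly_congr {d : ℕ} {e e' : (Fin s → ℕ) → ℤ}
    (h : ∀ α, ∑ i, α i ≤ d → e α = e' α) : numericalPoly d e = numericalPoly d e' := by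
  ext n
  rw [numericalPoly_eq, numericalPoly_eq]
  exact Finset.sum_congr rfl fun α hα => by rw [h α (mem_degreeLE.mp hα)]

theorem numericalPoly_sub (d : ℕ) (e e' : (Fin s → ℕ) → ℤ) :
    numericalPoly d (e - e') = numericalPoly d e - numericalPoly d e' := by
  ext n
  simp only [numericalPoly_eq, Pi.sub_apply, ← Finset.sum_sub_distrib, mul_sub, sub_mul]

theorem numericalPoly_eq_of_forall_ne_zero {d : ℕ} {e : (Fin s → ℕ) → ℤ}
    (he : ∀ α ≠ 0, ∑ i, α i ≤ d → e α = 0) (n : Fin s → ℤ) :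
    numericalPoly d e n = (-1) ^ d * e 0 := by
  rw [numericalPoly_eq, Finset.sum_eq_single_of_mem 0 (mem_degreeLE.mpr (by simp))]
  · simp [multiBinom_zero_right]
  · intro α hα hα0
    rw [he α hα0 (mem_degreeLE.mp hα), mul_zero, zero_mul]

theorem numericalPoly_single_zero (d : ℕ) (z : ℤ) (n : Fin s → ℤ) :
    numericalPoly d (Pi.single 0 z) n = (-1) ^ d * z := by
  rw [numericalPoly_eq_of_forall_ne_zero fun α hα _ => Pi.single_eq_of_ne hα _, Pi.single_eq_same]

theorem numericalPoly_zero_right (d : ℕ) (e : (Fin s → ℕ) → ℤ) :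
    numericalPoly d e 0 = (-1) ^ d * e 0 := by
  rw [numericalPoly_eq, Finset.sum_eq_single_of_mem 0 (mem_degreeLE.mpr (by simp))]
  · simp [multiBinom_zero_right]
  · intro α _ hα
    rw [multiBinom_zero_left hα, mul_zero]

theorem numericalPoly_zero_left (e : (Fin s → ℕ) → ℤ) (n : Fin s → ℤ) :
    numericalPoly 0 e n = e 0 := by
  rw [numericalPoly_eq_of_forall_ne_zero fun α hα hα0 => ?_, pow_zero, one_mul]
  obtain ⟨_, _, _, h⟩ := exists_eq_add_single_of_ne_zero hα hα0
  exact absurd h (Nat.not_succ_le_zero _)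

theorem fwdDiff_numericalPoly_one (e : (Fin s → ℕ) → ℤ) (i : Fin s) (n : Fin s → ℤ) :
    Δ_[Pi.single i 1] (numericalPoly 1 e) n = e (Pi.single i 1) := by
  rw [fwdDiff_numericalPoly, numericalPoly_zero_left, zero_add]

theorem fwdDiff_fwdDiff_numericalPoly_two (e : (Fin s → ℕ) → ℤ) (i j : Fin s) (n : Fin s → ℤ) :
    Δ_[Pi.single j 1] (Δ_[Pi.single i 1] (numericalPoly 2 e)) n =
      e (Pi.single j 1 + Pi.single i 1) := by
  rw [funext (fwdDiff_numericalPoly 1 e i), fwdDiff_comp_add, fwdDiff_numericalPoly_one]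

theorem Ici_induction {N : Fin s → ℤ} {P : (Fin s → ℤ) → Prop} (base : P N)
    (succ : ∀ n, N ≤ n → ∀ i, P n → P (n + Pi.single i 1)) {n : Fin s → ℤ} (hn : N ≤ n) : P n := by
  obtain ⟨k, hk⟩ : ∃ k : ℕ, ∑ i, (n i - N i) = k :=
    Int.eq_ofNat_of_zero_le (Finset.sum_nonneg fun i _ => sub_nonneg.mpr (hn i))
  induction k generalizing n with
  | zero =>
    rw [Nat.cast_zero, Finset.sum_eq_zero_iff_of_nonneg fun i _ => sub_nonneg.mpr (hn i)] at hk
    rwa [funext fun i => sub_eq_zero.mp (hk i (Finset.mem_univ i))]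
  | succ k ih =>
    obtain ⟨i, hi⟩ : ∃ i, N i < n i := by
      by_contra! hall
      have := Finset.sum_nonpos fun i (_ : i ∈ Finset.univ) => sub_nonpos.mpr (hall i)
      omega
    have hN : N ≤ n - Pi.single i 1 := by
      intro j
      rcases eq_or_ne j i with rfl | hj
      · simpa using Int.le_sub_one_of_lt hi
      · simpa [hj] using hn j
    have hsum : ∑ j, ((n - Pi.single i 1 : Fin s → ℤ) j - N j) = k := by
      simp only [Pi.sub_apply, sub_right_comm, Finset.sum_sub_distrib,
        Finset.sum_pi_single', Finset.mem_univ, if_true] at hk ⊢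
      push_cast at hk
      linarith
    simpa using succ _ hN i (ih hN hsum)

theorem antitoneOn_Ici_of_fwdDiff_nonpos {g : (Fin s → ℤ) → ℤ} {N : Fin s → ℤ}
    (h : ∀ n, N ≤ n → ∀ i, Δ_[Pi.single i 1] g n ≤ 0) : AntitoneOn g (Set.Ici N) :=
  fun n hn _ _ hnm => Ici_induction (P := fun m => g m ≤ g n) le_rfl
    (fun m hm i hgm => (sub_nonpos.mp (h m (hn.trans hm) i)).trans hgm) hnm

theorem eq_of_fwdDiff_eq_zero {g : (Fin s → ℤ) → ℤ} {N : Fin s → ℤ}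
    (h : ∀ n, N ≤ n → ∀ i, Δ_[Pi.single i 1] g n = 0) {n : Fin s → ℤ} (hn : N ≤ n) : g n = g N :=
  Ici_induction (P := fun n => g n = g N) rfl
    (fun n hn i hgn => (sub_eq_zero.mp (h n hn i)).trans hgn) hn

theorem eq_zero_of_fwdDiff_nonpos {g : (Fin s → ℤ) → ℤ} {N : Fin s → ℤ}
    (h : ∀ n, N ≤ n → ∀ i, Δ_[Pi.single i 1] g n ≤ 0) (hN : g N ≤ 0)
    (hev : ∀ᶠ n in atTop, g n = 0) {n : Fin s → ℤ} (hn : N ≤ n) : g n = 0 := by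
  have hanti := antitoneOn_Ici_of_fwdDiff_nonpos h
  obtain ⟨m, hm, hnm⟩ := (hev.and (eventually_ge_atTop n)).exists
  exact le_antisymm ((hanti Set.self_mem_Ici hn hn).trans hN)
    (hm.ge.trans (hanti hn (hn.trans hnm) hnm))

theorem fwdDiff_sub_apply (h : Fin s → ℤ) (g p : (Fin s → ℤ) → ℤ) (n : Fin s → ℤ) :
    Δ_[h] (g - p) n = Δ_[h] g n - Δ_[h] p n :=
  sub_sub_sub_comm ..

theorem eventually_add_single_iff {p : (Fin s → ℤ) → Prop} (i : Fin s) :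
    (∀ᶠ n : Fin s → ℤ in atTop, p (n + Pi.single i 1)) ↔ ∀ᶠ n in atTop, p n := by
  conv_rhs => rw [← (OrderIso.addRight (Pi.single i 1 : Fin s → ℤ)).map_atTop, eventually_map]
  rfl

theorem eventually_fwdDiff_eq {g h : (Fin s → ℤ) → ℤ} (hgh : ∀ᶠ n in atTop, g n = h n)
    (i : Fin s) : ∀ᶠ n in atTop, Δ_[Pi.single i 1] g n = Δ_[Pi.single i 1] h n := by
  filter_upwards [hgh, (eventually_add_single_iff i).mpr hgh] with n hn hni
  rw [fwdDiff, fwdDiff, hn, hni]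

theorem fwdDiff_sub_nonpos_of_le_of_eventually_eq {g p : (Fin s → ℤ) → ℤ} {i : Fin s} {c c' : ℤ}
    (hp : ∀ n, Δ_[Pi.single i 1] p n = c') (hgp : ∀ᶠ n in atTop, g n = p n)
    (hg : ∀ᶠ n in atTop, Δ_[Pi.single i 1] g n = c) {n : Fin s → ℤ}
    (hn : Δ_[Pi.single i 1] g n ≤ c) : Δ_[Pi.single i 1] (g - p) n ≤ 0 := by
  obtain ⟨m, hgm, hgpm⟩ := (hg.and (eventually_fwdDiff_eq hgp i)).exists
  have hc : c = c' := hgm.symm.trans (hgpm.trans (hp m))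
  rw [fwdDiff_sub_apply, hp, ← hc]
  exact sub_nonpos.mpr hn

theorem eq_zero_of_eventually_numericalPoly_eq_zero {d : ℕ} {e : (Fin s → ℕ) → ℤ}
    (h : ∀ᶠ n in atTop, numericalPoly d e n = 0) {α : Fin s → ℕ} (hα : ∑ i, α i ≤ d) :
    e α = 0 := by
  induction d generalizing e α with
  | zero =>
    obtain ⟨n, hn⟩ := h.exists
    obtain rfl : α = 0 := by
      by_contra hα0
      obtain ⟨_, _, _, hβ⟩ := exists_eq_add_single_of_ne_zero hα0 hα
      exact Nat.not_succ_le_zero _ hβ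
    rwa [numericalPoly_zero_left] at hn
  | succ d ih =>
    have hne : ∀ β ≠ 0, ∑ i, β i ≤ d + 1 → e β = 0 := by
      intro β hβ0 hβ
      obtain ⟨γ, i, rfl, hγ⟩ := exists_eq_add_single_of_ne_zero hβ0 hβ
      have hdiff := eventually_fwdDiff_eq h i
      simp only [fwdDiff_numericalPoly, fwdDiff_const] at hdiff
      exact ih (e := fun β => e (β + Pi.single i 1)) ((eventually_add_single_iff i).mp hdiff)
        (Nat.le_of_succ_le_succ hγ)
    rcases eq_or_ne α 0 with rfl | hα0
    · obtain ⟨n, hn⟩ := h.exists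
      simpa [numericalPoly_eq_of_forall_ne_zero hne] using hn
    · exact hne α hα0 hα

theorem exists_forall_add_single_eq {d : ℕ} {f : Fin s → (Fin s → ℕ) → ℤ}
    (hf : ∀ i j (γ : Fin s → ℕ), ∑ k, γ k + 1 ≤ d →
      f i (γ + Pi.single j 1) = f j (γ + Pi.single i 1)) :
    ∃ e : (Fin s → ℕ) → ℤ, ∀ i (α : Fin s → ℕ), ∑ k, α k ≤ d → e (α + Pi.single i 1) = f i α := by
  classical
  refine ⟨fun β => if h : ∃ i, β i ≠ 0 then f h.choose (β - Pi.single h.choose 1) else 0,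
    fun i α hα => ?_⟩
  have hne : ∃ j, (α + Pi.single i 1 : Fin s → ℕ) j ≠ 0 := ⟨i, by simp⟩
  dsimp only
  rw [dif_pos hne]
  have hj := hne.choose_spec
  generalize hne.choose = j at hj ⊢
  rcases eq_or_ne j i with hji | hji
  · rw [hji, add_tsub_cancel_right]
  · rw [Pi.add_apply, Pi.single_eq_of_ne hji, add_zero] at hj
    obtain ⟨γ, rfl⟩ := exists_eq_add_single hj
    rw [sum_add_single] at hα
    rw [add_right_comm, add_tsub_cancel_right, hf j i γ hα]

theorem apply_add_single_comm_of_eventually_fwdDiff_eq {d : ℕ} {H : (Fin s → ℤ) → ℤ}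
    {f : Fin s → (Fin s → ℕ) → ℤ} (hf : ∀ i, ∀ᶠ n in atTop,
      Δ_[Pi.single i 1] H n = numericalPoly (d + 1) (f i) (n + Pi.single i 1))
    (i j : Fin s) {γ : Fin s → ℕ} (hγ : ∑ k, γ k ≤ d) :
    f i (γ + Pi.single j 1) = f j (γ + Pi.single i 1) := by
  have hΔΔ (i j : Fin s) : ∀ᶠ n in atTop, Δ_[Pi.single j 1] (Δ_[Pi.single i 1] H) n =
      numericalPoly d (fun α => f i (α + Pi.single j 1)) (n + Pi.single i 1 + Pi.single j 1) := by
    filter_upwards [eventually_fwdDiff_eq (hf i) j] with n hn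
    rw [hn, ← fwdDiff_numericalPoly, fwdDiff, fwdDiff, add_right_comm]
  refine sub_eq_zero.mp (eq_zero_of_eventually_numericalPoly_eq_zero
    (e := fun α => f i (α + Pi.single j 1) - f j (α + Pi.single i 1)) ?_ hγ)
  rw [← eventually_add_single_iff j, ← eventually_add_single_iff i]
  filter_upwards [hΔΔ i j, hΔΔ j i] with n hij hji
  rw [← Pi.sub_def, numericalPoly_sub, Pi.sub_apply, ← hij, add_right_comm, ← hji, sub_eq_zero]
  simp only [fwdDiff, add_right_comm n (Pi.single i 1)]
  abel

theorem exists_eventually_numericalPoly_succ_eq {d : ℕ} {H : (Fin s → ℤ) → ℤ}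
    (h : ∀ i, ∃ f, ∀ᶠ n in atTop,
      Δ_[Pi.single i 1] H n = numericalPoly d f (n + Pi.single i 1)) :
    ∃ e, ∀ᶠ n in atTop, numericalPoly (d + 1) e n = H n := by
  choose f hf using h
  have hcomm (i j : Fin s) (γ : Fin s → ℕ) (hγ : ∑ k, γ k + 1 ≤ d) :
      f i (γ + Pi.single j 1) = f j (γ + Pi.single i 1) := by
    cases d with
    | zero => exact absurd hγ (Nat.not_succ_le_zero _)
    | succ d =>
      exact apply_add_single_comm_of_eventually_fwdDiff_eq hf i j (Nat.le_of_succ_le_succ hγ)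
  obtain ⟨e, he⟩ := exists_forall_add_single_eq hcomm
  have hΔ (i : Fin s) :
      ∀ᶠ n in atTop, Δ_[Pi.single i 1] (numericalPoly (d + 1) e - H) n = 0 := by
    filter_upwards [hf i] with n hn
    rw [fwdDiff_sub_apply, hn, fwdDiff_numericalPoly, numericalPoly_congr (he i), sub_self]
  obtain ⟨N, hN⟩ := eventually_atTop.mp (eventually_all.mpr hΔ)
  refine ⟨e - Pi.single 0 ((-1) ^ (d + 1) * (numericalPoly (d + 1) e - H) N),
    (eventually_ge_atTop N).mono fun n hn => ?_⟩
  have hconst := eq_of_fwdDiff_eq_zero hN hn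
  rw [numericalPoly_sub, Pi.sub_apply, numericalPoly_single_zero, ← hconst, ← mul_assoc, ← mul_pow,
    neg_one_mul, neg_neg, one_pow, one_mul, Pi.sub_apply, sub_sub_cancel]

theorem exists_eventually_numericalPoly_one_eq {H : (Fin s → ℤ) → ℤ}
    (h : ∀ i, ∃ c, ∀ᶠ n in atTop, Δ_[Pi.single i 1] H n = c) :
    ∃ e, ∀ᶠ n in atTop, numericalPoly 1 e n = H n := by
  refine exists_eventually_numericalPoly_succ_eq fun i => ?_
  obtain ⟨c, hc⟩ := h i
  refine ⟨fun _ => c, hc.mono fun n hn => ?_⟩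
  rw [hn, numericalPoly_zero_left]

theorem exists_eventually_numericalPoly_two_eq {H : (Fin s → ℤ) → ℤ}
    (h : ∀ i j, ∃ c, ∀ᶠ n in atTop, Δ_[Pi.single j 1] (Δ_[Pi.single i 1] H) n = c) :
    ∃ e, ∀ᶠ n in atTop, numericalPoly 2 e n = H n := by
  refine exists_eventually_numericalPoly_succ_eq fun i => ?_
  obtain ⟨f, hf⟩ := exists_eventually_numericalPoly_one_eq
    (H := fun n => Δ_[Pi.single i 1] H (n - Pi.single i 1)) fun j => by
      obtain ⟨c, hc⟩ := h i j
      refine ⟨c, (eventually_add_single_iff i).mp (hc.mono fun n hn => ?_)⟩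
      rwa [fwdDiff, add_right_comm, add_sub_cancel_right, add_sub_cancel_right]
  refine ⟨f, ((eventually_add_single_iff i).mpr hf).mono fun n hn => ?_⟩
  rw [hn, add_sub_cancel_right]

end NumericalPolynomials

/-! ### Ratliff-Rush closure and local cohomology -/

section RatliffRush

variable {R : Type*} [CommRing R] {s : ℕ}

theorem IsLaurentHomogeneous.eq_single {n : Fin s → ℤ} {f : LaurentRing R s}
    (hf : IsLaurentHomogeneous n f) : f = AddMonoidAlgebra.single n (f.coeff n) := by
  refine AddMonoidAlgebra.ext (Finsupp.ext fun k => ?_)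
  rw [AddMonoidAlgebra.coeff_single]
  rcases eq_or_ne k n with rfl | hk
  · rw [Finsupp.single_eq_same]
  · rw [Finsupp.single_eq_of_ne hk, hf k hk]

theorem isLaurentHomogeneous_single (n : Fin s → ℤ) (r : R) :
    IsLaurentHomogeneous n (AddMonoidAlgebra.single n r) := fun k hk => by
  rw [AddMonoidAlgebra.coeff_single, Finsupp.single_eq_of_ne hk]

theorem IsLaurentHomogeneous.single_mul_pow {n m : Fin s → ℤ} {f : LaurentRing R s}
    (hf : IsLaurentHomogeneous m f) (r : R) (k : ℕ) :
    IsLaurentHomogeneous (n + k • m) (AddMonoidAlgebra.single n r * f ^ k) := by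
  rw [hf.eq_single, AddMonoidAlgebra.single_pow, AddMonoidAlgebra.single_mul_single]
  exact isLaurentHomogeneous_single _ _

theorem single_mem_nonZeroDivisors (n : Fin s → ℤ) {a : R} (ha : a ∈ nonZeroDivisors R) :
    (AddMonoidAlgebra.single n a : LaurentRing R s) ∈ nonZeroDivisors (LaurentRing R s) := by
  rw [mem_nonZeroDivisors_iff_right]
  refine fun f hf => AddMonoidAlgebra.ext (Finsupp.ext fun p => ?_)
  have hcoeff : (f * AddMonoidAlgebra.single n a).coeff (p + n) = 0 := by rw [hf]; rfl
  rwa [AddMonoidAlgebra.coeff_mul_single_add, mul_right_mem_nonZeroDivisors_eq_zero_iff ha]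
    at hcoeff

theorem truncFamily_of_le {c n : Fin s → ℤ} (h : c ≤ n) (a : (Fin s → ℤ) → Ideal R) :
    truncFamily c a n = a n := if_pos h

theorem truncFamily_of_not_le {c n : Fin s → ℤ} (h : ¬c ≤ n) (a : (Fin s → ℤ) → Ideal R) :
    truncFamily c a n = ⊥ := if_neg h

theorem truncFamily_anti {c d : Fin s → ℤ} (h : c ≤ d) (a : (Fin s → ℤ) → Ideal R)
    (n : Fin s → ℤ) : truncFamily d a n ≤ truncFamily c a n := by
  by_cases hd : d ≤ n
  · rw [truncFamily_of_le hd, truncFamily_of_le (h.trans hd)]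
  · rw [truncFamily_of_not_le hd]
    exact bot_le

theorem truncFamily_mul_truncFamily_le {a : (Fin s → ℤ) → Ideal R}
    (ha : ∀ n m, a n * a m ≤ a (n + m)) (c d n m : Fin s → ℤ) :
    truncFamily c a n * truncFamily d a m ≤ truncFamily (c + d) a (n + m) := by
  by_cases hc : c ≤ n
  · by_cases hd : d ≤ m
    · rw [truncFamily_of_le hc, truncFamily_of_le hd, truncFamily_of_le (add_le_add hc hd)]
      exact ha n m
    · rw [truncFamily_of_not_le hd, Ideal.mul_bot]
      exact bot_le
  · rw [truncFamily_of_not_le hc, Ideal.bot_mul]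
    exact bot_le

theorem coeff_pow_mem_truncFamily {I : Fin s → Ideal R} {f : LaurentRing R s}
    (hf : ∀ q, f.coeff q ∈ truncFamily 1 (multiPow I) q) (k : ℕ) (q : Fin s → ℤ) :
    (f ^ k).coeff q ∈ truncFamily (k : Fin s → ℤ) (multiPow I) q := by
  induction k generalizing q with
  | zero =>
    rw [pow_zero, Nat.cast_zero]
    refine single_coeff_mem_iff.mpr ?_ q
    rw [truncFamily_multiPow_zero]
    exact Submodule.mem_top
  | succ k ih =>
    rw [pow_succ, Nat.cast_succ]
    refine laurent_coeff_mul_mem fun a b hab => ?_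
    rw [← hab]
    exact truncFamily_mul_truncFamily_le (multiPow_mul_le I) _ _ _ _
      (Ideal.mul_mem_mul (ih a) (hf b))

theorem exists_mem_reesIrrelevant_nonZeroDivisor {I : Fin s → Ideal R}
    (hreg : ∃ a ∈ multiPow I 1, a ∈ nonZeroDivisors R) :
    ∃ w ∈ reesIrrelevant I, (w : LaurentRing R s) ∈ nonZeroDivisors (LaurentRing R s) := by
  obtain ⟨a, haI, ha⟩ := hreg
  have hw : ∀ q, (AddMonoidAlgebra.single 1 a : LaurentRing R s).coeff q ∈
      truncFamily 1 (multiPow I) q :=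
    single_coeff_mem_iff.mpr (by rwa [truncFamily_of_le le_rfl])
  have hw' : (AddMonoidAlgebra.single 1 a : LaurentRing R s) ∈ reesRing I :=
    fun q => truncFamily_anti zero_le_one _ q (hw q)
  exact ⟨⟨_, hw'⟩, hw, single_mem_nonZeroDivisors 1 ha⟩

theorem eq_zero_of_forall_pow_mul_eq_zero {I : Fin s → Ideal R}
    (hreg : ∃ a ∈ multiPow I 1, a ∈ nonZeroDivisors R) {m : ℕ} {x : Fin m → reesRing I}
    (hspan : Ideal.span (Set.range x) = reesIrrelevant I) {f : LaurentRing R s}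
    (hf : ∀ j, ∃ l, (x j : LaurentRing R s) ^ l * f = 0) : f = 0 := by
  let ann : Ideal (reesRing I) :=
    LinearMap.ker (LinearMap.toSpanSingleton (reesRing I) (LaurentRing R s) f)
  have hrad : reesIrrelevant I ≤ ann.radical := by
    rw [← hspan, Ideal.span_le]
    rintro _ ⟨j, rfl⟩
    exact hf j
  obtain ⟨w, hwI, hw⟩ := exists_mem_reesIrrelevant_nonZeroDivisor hreg
  obtain ⟨l, hl⟩ := hrad hwI
  exact (mul_left_mem_nonZeroDivisors_eq_zero_iff (pow_mem hw l)).mp hl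

theorem multiPow_add (I : Fin s → Ideal R) {n m : Fin s → ℤ} (hn : 0 ≤ n) (hm : 0 ≤ m) :
    multiPow I (n + m) = multiPow I n * multiPow I m := by
  unfold multiPow
  rw [← Finset.prod_mul_distrib]
  refine Finset.prod_congr rfl fun i _ => ?_
  rw [← pow_add, Pi.add_apply, Int.toNat_add (hn i) (hm i)]

variable {I : Fin s → Ideal R}

/-- `F(n)` equals its Ratliff-Rush closure, the union of the ideals `F(n + (k, …, k)) : I^(k, …, k)`
over `k ∈ ℕ`. -/
def MultiFiltration.IsRatliffRushClosedAt (F : MultiFiltration I) (n : Fin s → ℤ) : Prop :=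
  ∀ k : ℕ, (F.ideal (n + k)).colon (multiPow I (k : Fin s → ℤ) : Set R) ≤ F.ideal n

theorem MultiFiltration.colon_multiPow_le (F : MultiFiltration I) (n : Fin s → ℤ)
    {p q : Fin s → ℤ} (hp : 0 ≤ p) (hpq : p ≤ q) :
    (F.ideal (n + p)).colon (multiPow I p : Set R) ≤
      (F.ideal (n + q)).colon (multiPow I q : Set R) := by
  intro r hr
  rw [Submodule.mem_colon] at hr ⊢
  intro u hu
  rw [← sub_add_cancel q p, multiPow_add I (sub_nonneg.mpr hpq) hp] at hu
  refine Submodule.mul_induction_on hu (fun a ha b hb => ?_) fun v w hv hw => ?_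
  · have hmem := F.multiPow_mul_ideal_le _ _ (Ideal.mul_mem_mul ha (hr b hb))
    rwa [add_left_comm, sub_add_cancel, mul_smul_comm] at hmem
  · rw [smul_add]
    exact add_mem hv hw

theorem MultiFiltration.single_mul_pow_mem_reesModule (F : MultiFiltration I) {n : Fin s → ℤ}
    (hn : 0 ≤ n) {r : R} {k : ℕ}
    (hr : r ∈ (F.ideal (n + k)).colon (multiPow I (k : Fin s → ℤ) : Set R)) {f : LaurentRing R s}
    (hf : ∀ q, f.coeff q ∈ truncFamily 1 (multiPow I) q) :
    AddMonoidAlgebra.single n r * f ^ k ∈ reesModule F := by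
  have hk : (0 : Fin s → ℤ) ≤ k := Nat.cast_nonneg k
  intro q
  obtain ⟨q, rfl⟩ : ∃ p, q = n + p := ⟨q - n, (add_sub_cancel n q).symm⟩
  rw [AddMonoidAlgebra.coeff_single_mul_add]
  have hcoeff := coeff_pow_mem_truncFamily hf k q
  by_cases hq : (k : Fin s → ℤ) ≤ q
  · rw [truncFamily_of_le hq] at hcoeff
    rw [truncFamily_of_le (add_nonneg hn (hk.trans hq))]
    exact Submodule.mem_colon.mp (F.colon_multiPow_le n hk hq hr) _ hcoeff
  · rw [truncFamily_of_not_le hq, Ideal.mem_bot] at hcoeff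
    rw [hcoeff, mul_zero]
    exact zero_mem _

section Cech

variable {S M : Type*} [CommRing S] [AddCommGroup M] [Module S M]

theorem awayMap_mk_pow {a c : S} (h : a ∣ c) (k : ℕ) (u : M) :
    a ^ k • awayMap M h (LocalizedModule.mk u
      ⟨a ^ k, Submonoid.pow_mem _ (Submonoid.mem_powers a) k⟩) =
        LocalizedModule.mkLinearMap (Submonoid.powers c) M u := by
  have hmk : a ^ k • (LocalizedModule.mk u
      ⟨a ^ k, Submonoid.pow_mem _ (Submonoid.mem_powers a) k⟩ :
        LocalizedModule (Submonoid.powers a) M) = LocalizedModule.mkLinearMap _ M u := by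
    rw [LocalizedModule.smul'_mk]
    exact LocalizedModule.mk_cancel (⟨a ^ k, _⟩ : Submonoid.powers a) u
  rw [← map_smul, hmk]
  exact LinearMap.congr_fun (LocalizedModule.lift_comp _ _ (isUnit_algebraMap_away_of_dvd M h)) u

variable {m : ℕ} {x : Fin m → S}

theorem mk_pow_mem_ker_cechD1 {k : ℕ} {U : Fin m → M}
    (hU : ∀ i j, x i ^ k • U j = x j ^ k • U i) :
    (fun j => LocalizedModule.mk (U j)
      ⟨x j ^ k, Submonoid.pow_mem _ (Submonoid.mem_powers _) k⟩) ∈ LinearMap.ker (cechD1 M x) := by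
  set c : ∀ j, LocalizedModule (Submonoid.powers (x j)) M := fun j => LocalizedModule.mk (U j)
    ⟨x j ^ k, Submonoid.pow_mem _ (Submonoid.mem_powers _) k⟩ with hc
  rw [LinearMap.mem_ker]
  ext1 ⟨⟨i, j⟩, _⟩
  refine sub_eq_zero.mpr (IsLocalizedModule.smul_injective
    (LocalizedModule.mkLinearMap (Submonoid.powers (x i * x j)) M)
    ⟨(x i * x j) ^ k, Submonoid.pow_mem _ (Submonoid.mem_powers _) k⟩ ?_)
  change (x i * x j) ^ k • awayMap M (Dvd.intro_left (x i) rfl) (c j) =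
    (x i * x j) ^ k • awayMap M (Dvd.intro (x j) rfl) (c i)
  rw [hc, mul_pow, mul_smul, awayMap_mk_pow, mul_comm (x i ^ k), mul_smul, awayMap_mk_pow,
    ← map_smul, ← map_smul, hU]

theorem exists_forall_smul_eq_of_cechH1Component_eq_bot {G : Type*} [AddCommGroup G]
    {comp : G → AddSubgroup M} {δ : Fin m → G} {n : G} (hbot : cechH1Component x comp δ n = ⊥)
    {k : ℕ} {U : Fin m → M} (hUn : ∀ j, U j ∈ comp (n + k • δ j))
    (hU : ∀ i j, x i ^ k • U j = x j ^ k • U i) :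
    ∃ u : M, ∀ j, ∃ l : ℕ, x j ^ l • x j ^ k • u = x j ^ l • U j := by
  let c : LinearMap.ker (cechD1 M x) := ⟨_, mk_pow_mem_ker_cechD1 hU⟩
  have hzero : (Submodule.Quotient.mk c : CechH1 M x) = 0 := by
    rw [← AddSubgroup.mem_bot, ← hbot]
    exact AddSubgroup.subset_closure ⟨c, fun j => ⟨k, U j, hUn j, rfl⟩, rfl⟩
  obtain ⟨u, hu⟩ := (Submodule.Quotient.mk_eq_zero _).mp hzero
  refine ⟨u, fun j => ?_⟩
  obtain ⟨⟨_, l, rfl⟩, hl⟩ := LocalizedModule.mk_eq.mp (congrFun hu j)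
  exact ⟨l, hl.trans (congrArg _ (one_smul _ _))⟩

end Cech

theorem MultiFiltration.isRatliffRushClosedAt_of_cechH1Component_eq_bot (F : MultiFiltration I)
    (hreg : ∃ a ∈ multiPow I 1, a ∈ nonZeroDivisors R) {m : ℕ} {x : Fin m → reesRing I}
    {δ : Fin m → (Fin s → ℤ)} (hhom : ∀ j, IsLaurentHomogeneous (δ j) (x j : LaurentRing R s))
    (hspan : Ideal.span (Set.range x) = reesIrrelevant I) {n : Fin s → ℤ} (hn : 0 ≤ n)
    (hbot : cechH1Component (M := reesModule F) x (reesComponent F) δ n = ⊥) :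
    F.IsRatliffRushClosedAt n := by
  intro k r hr
  have hx (j : Fin m) (q) : (x j : LaurentRing R s).coeff q ∈ truncFamily 1 (multiPow I) q := by
    have hxj : x j ∈ reesIrrelevant I := hspan ▸ Ideal.subset_span ⟨j, rfl⟩
    exact hxj q
  -- the fractions `r tⁿ xⱼᵏ / xⱼᵏ` form a Čech cocycle of degree `n`, hence a coboundary
  let U : Fin m → reesModule F := fun j => ⟨_, F.single_mul_pow_mem_reesModule hn hr (hx j)⟩
  have hU (i j : Fin m) : x i ^ k • U j = x j ^ k • U i := by
    ext1
    simp only [U, Submodule.coe_smul, Subalgebra.smul_def, SubmonoidClass.coe_pow, smul_eq_mul]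
    ring
  obtain ⟨u, hu⟩ := exists_forall_smul_eq_of_cechH1Component_eq_bot hbot
    (fun j => (hhom j).single_mul_pow r k) hU
  have huz : (u : LaurentRing R s) - AddMonoidAlgebra.single n r = 0 := by
    refine eq_zero_of_forall_pow_mul_eq_zero hreg hspan fun j => ?_
    obtain ⟨l, hl⟩ := hu j
    have hlval := congrArg Subtype.val hl
    simp only [U, Submodule.coe_smul, Subalgebra.smul_def, SubmonoidClass.coe_pow, smul_eq_mul]
      at hlval
    exact ⟨l + k, by linear_combination hlval⟩
  have hun := single_coeff_mem_iff.mp (sub_eq_zero.mp huz ▸ u.2)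
  rwa [truncFamily_of_le hn] at hun

end RatliffRush

/-! ### The Hilbert function -/

section HilbertFunction

open Filter RingTheory.Sequence
open scoped fwdDiff

variable {R : Type*} [CommRing R] {s : ℕ} {I : Fin s → Ideal R} (F : MultiFiltration I)

theorem exists_pow_le_multiPow [IsLocalRing R] (hmI : ∀ i, ∃ k, maximalIdeal R ^ k ≤ I i)
    (n : Fin s → ℤ) : ∃ k, maximalIdeal R ^ k ≤ multiPow I n := by
  choose k hk using hmI
  refine ⟨∑ i, k i * (n i).toNat, ?_⟩
  rw [← Finset.prod_pow_eq_pow_sum]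
  refine Finset.prod_le_prod' fun i _ => ?_
  rw [pow_mul]
  exact Ideal.pow_right_mono (hk i) _

namespace MultiFiltration

theorem ideal_eq_top_of_nonpos {n : Fin s → ℤ} (hn : n ≤ 0) : F.ideal n = ⊤ :=
  top_le_iff.mp ((multiPow_of_nonpos I hn).symm.le.trans (F.multiPow_le n))

theorem isRatliffRushClosedAt_of_nonpos {n : Fin s → ℤ} (hn : n ≤ 0) :
    F.IsRatliffRushClosedAt n := fun _ => by
  rw [F.ideal_eq_top_of_nonpos hn]
  exact le_top

theorem hilbertFunction_of_nonpos {n : Fin s → ℤ} (hn : n ≤ 0) : F.hilbertFunction n = 0 := by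
  have hlength : Module.length R (R ⧸ F.ideal n) = 0 := by
    rw [F.ideal_eq_top_of_nonpos hn, Module.length_eq_zero_iff, Ideal.Quotient.subsingleton_iff]
  rw [hilbertFunction, hlength]
  rfl

theorem eventually_hilbertPoly_eq {d : ℕ}
    (h : ∃ e, ∀ᶠ n in atTop, numericalPoly d e n = F.hilbertFunction n) :
    ∀ᶠ n in atTop, F.hilbertPoly d n = F.hilbertFunction n := by
  have hex : ∃ e, F.IsHilbertCoeff d e := h.imp fun _ => eventually_atTop.mp
  have hcoeff : F.hilbertCoeff d = hex.choose := dif_pos hex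
  unfold hilbertPoly
  rw [hcoeff]
  exact eventually_atTop.mpr hex.choose_spec

theorem fwdDiff_hilbertFunction_sub_hilbertPoly_two_zero_nonpos
    {i : Fin s} (he : F.hilbertCoeff 2 (Pi.single i 1) ≤ 0)
    (hΔΔ : ∀ n, F.IsRatliffRushClosedAt n → Δ_[Pi.single i 1]
      (Δ_[Pi.single i 1] (F.hilbertFunction - F.hilbertPoly 2)) n ≤ 0) :
    Δ_[Pi.single i 1] (F.hilbertFunction - F.hilbertPoly 2) 0 ≤ 0 := by
  have hneg : (-Pi.single i 1 : Fin s → ℤ) ≤ 0 :=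
    neg_nonpos.mpr (Pi.single_nonneg.mpr zero_le_one)
  have hΔP : Δ_[Pi.single i 1] (F.hilbertPoly 2) (-Pi.single i 1) =
      -F.hilbertCoeff 2 (Pi.single i 1) := by
    refine (fwdDiff_numericalPoly 1 (F.hilbertCoeff 2) i _).trans ?_
    rw [neg_add_cancel, numericalPoly_zero_right, pow_one, zero_add, neg_one_mul]
  have hΔH : Δ_[Pi.single i 1] F.hilbertFunction (-Pi.single i 1) = 0 := by
    rw [fwdDiff, neg_add_cancel, F.hilbertFunction_of_nonpos le_rfl,
      F.hilbertFunction_of_nonpos hneg, sub_zero]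
  calc Δ_[Pi.single i 1] (F.hilbertFunction - F.hilbertPoly 2) 0
      ≤ Δ_[Pi.single i 1] (F.hilbertFunction - F.hilbertPoly 2) (-Pi.single i 1) := by
        have hstep := hΔΔ _ (F.isRatliffRushClosedAt_of_nonpos hneg)
        rwa [fwdDiff, neg_add_cancel, sub_nonpos] at hstep
    _ = F.hilbertCoeff 2 (Pi.single i 1) := by rw [fwdDiff_sub_apply, hΔH, hΔP, zero_sub, neg_neg]
    _ ≤ 0 := he

theorem span_singleton_mul_ideal_le {i : Fin s} {a : R} (ha : a ∈ I i) (n : Fin s → ℤ) :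
    Ideal.span {a} * F.ideal n ≤ F.ideal (n + Pi.single i 1) :=
  Ideal.span_singleton_mul_le_iff.mpr fun _ hx =>
    IsMultiPowStable.mul_mem_add_single F.multiPow_mul_ideal_le ha hx

theorem colon_inf_colon_le_of_isRatliffRushClosedAt {i j : Fin s} {a c : R} {p₀ : ℤ}
    (hred : ∀ n : Fin s → ℤ, p₀ ≤ n i → p₀ ≤ n j → F.ideal (n + Pi.single i 1 + Pi.single j 1) ≤
      Ideal.span {a} * F.ideal (n + Pi.single j 1) ⊔ Ideal.span {c} * F.ideal (n + Pi.single i 1))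
    {n : Fin s → ℤ} (hn : F.IsRatliffRushClosedAt n) :
    (F.ideal (n + Pi.single j 1)).colon {c} ⊓ (F.ideal (n + Pi.single i 1)).colon {a} ≤
      F.ideal n := by
  intro x hx
  have hxc : x * c ∈ F.ideal (n + Pi.single j 1) := Submodule.mem_colon_singleton.mp hx.1
  have hxa : x * a ∈ F.ideal (n + Pi.single i 1) := Submodule.mem_colon_singleton.mp hx.2
  set k : ℕ := (p₀ + 2).toNat
  set q : Fin s → ℤ := (k : Fin s → ℤ) - Pi.single i 1 - Pi.single j 1 with hq
  have hqk : q + Pi.single i 1 + Pi.single j 1 = (k : Fin s → ℤ) := by rw [hq]; abel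
  have hq_le (l : Fin s) : p₀ ≤ q l := by
    have hk : p₀ + 2 ≤ (k : ℤ) := Int.self_le_toNat _
    have single_le (l' : Fin s) : (Pi.single l' 1 : Fin s → ℤ) l ≤ 1 := by
      rw [Pi.single_apply]
      split_ifs <;> norm_num
    have := single_le i
    have := single_le j
    simp only [hq, Pi.sub_apply, Pi.natCast_apply]
    omega
  refine hn k (Submodule.mem_colon.mpr fun u hu => ?_)
  obtain ⟨_, hleft, _, hright, rfl⟩ := Submodule.mem_sup.mp
    (hred q (hq_le i) (hq_le j) (by rw [hqk]; exact F.multiPow_le _ hu))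
  obtain ⟨y, hy, rfl⟩ := Ideal.mem_span_singleton_mul.mp hleft
  obtain ⟨z, hz, rfl⟩ := Ideal.mem_span_singleton_mul.mp hright
  have hay : x * a * y ∈ F.ideal (n + k) := by
    convert F.mul_le _ _ (Ideal.mul_mem_mul hxa hy) using 2
    rw [← hqk]
    abel
  have hcz : x * c * z ∈ F.ideal (n + k) := by
    convert F.mul_le _ _ (Ideal.mul_mem_mul hxc hz) using 2
    rw [← hqk]
    abel
  rw [smul_eq_mul, mul_add, ← mul_assoc, ← mul_assoc]
  exact add_mem hay hcz

theorem length_quotient_add_length_quotient_of_colon_inf_colon_le {i j : Fin s} {a c : R}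
    (ha : a ∈ I i) (hc : c ∈ I j) (hac : IsWeaklyRegular R [a, c]) {n : Fin s → ℤ}
    (hn : (F.ideal (n + Pi.single j 1)).colon {c} ⊓ (F.ideal (n + Pi.single i 1)).colon {a} ≤
      F.ideal n) :
    Module.length R (R ⧸ (Ideal.span {a} * F.ideal (n + Pi.single j 1) ⊔
        Ideal.span {c} * F.ideal (n + Pi.single i 1))) + Module.length R (R ⧸ F.ideal n) =
      Module.length R (R ⧸ (Ideal.span {a} ⊔ Ideal.span {c})) +
        (Module.length R (R ⧸ F.ideal (n + Pi.single j 1)) +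
          Module.length R (R ⧸ F.ideal (n + Pi.single i 1))) := by
  have hle {l : Fin s} {b : R} (hb : b ∈ I l) :
      F.ideal n ≤ (F.ideal (n + Pi.single l 1)).colon {b} := fun x hx => by
    rw [Submodule.mem_colon_singleton, smul_eq_mul, mul_comm]
    exact IsMultiPowStable.mul_mem_add_single F.multiPow_mul_ideal_le hb hx
  rw [← length_quotient_span_mul_sup_span_mul hac, hn.antisymm (le_inf (hle hc) (hle ha))]

variable [IsLocalRing R]

variable [IsNoetherianRing R]

theorem exists_natCast_eq_hilbertFunction (hmI : ∀ i, ∃ k, maximalIdeal R ^ k ≤ I i) :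
    ∃ h : (Fin s → ℤ) → ℕ, ∀ n, Module.length R (R ⧸ F.ideal n) = h n ∧
      F.hilbertFunction n = h n := by
  refine ⟨fun n => (Module.length R (R ⧸ F.ideal n)).toNat, fun n => ⟨?_, rfl⟩⟩
  obtain ⟨k, hk⟩ := exists_pow_le_multiPow hmI n
  rw [ENat.natCast_toNat (length_quotient_ne_top ⟨k, hk.trans (F.multiPow_le n)⟩)]

variable [Infinite (ResidueField R)]

theorem exists_fwdDiff_hilbertFunction_le_and_eventually_eq (hdim : ringKrullDim R = 1)
    (hdepth : maximalIdeal R ∉ associatedPrimes R R) (hIm : ∀ i, I i ≤ maximalIdeal R)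
    (hmI : ∀ i, ∃ k, maximalIdeal R ^ k ≤ I i)
    (hF : Module.Finite (extReesRing I) (extReesModule F)) (i : Fin s) :
    ∃ c, (∀ n, Δ_[Pi.single i 1] F.hilbertFunction n ≤ c) ∧
      ∀ᶠ n in atTop, Δ_[Pi.single i 1] F.hilbertFunction n = c := by
  obtain ⟨a, haI, ha, hk, p₀, hp₀⟩ := exists_principal_reduction hdim hdepth hIm hmI
    F.multiPow_mul_ideal_le (IsMultiPowStable.isFiniteFamily_of_familyModule_fg _
      (Module.Finite.iff_fg.mp hF)) (fun _ => F.ideal_eq_top_of_nonpos) i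
  obtain ⟨h, hh⟩ := F.exists_natCast_eq_hilbertFunction hmI
  obtain ⟨c, hc⟩ := ENat.ne_top_iff_exists.mp (length_quotient_ne_top hk)
  have hlength (n : Fin s → ℤ) :
      Module.length R (R ⧸ (Ideal.span {a} * F.ideal n)) = ((c + h n : ℕ) : ℕ∞) := by
    rw [length_quotient_span_singleton_mul ha, ← hc, (hh n).1, Nat.cast_add]
  have hle (n : Fin s → ℤ) := F.span_singleton_mul_ideal_le haI n
  refine ⟨c, fun n => ?_, (eventually_ge_atTop fun _ => p₀).mono fun n hn => ?_⟩
  · have hle' := length_quotient_anti (hle n)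
    rw [hlength, (hh _).1, Nat.cast_le] at hle'
    rw [fwdDiff, (hh _).2, (hh _).2]
    omega
  · have heq := hlength n
    rw [(hle n).antisymm (hp₀ n (hn i)), (hh _).1, Nat.cast_inj] at heq
    rw [fwdDiff, (hh _).2, (hh _).2]
    omega

theorem exists_fwdDiff_fwdDiff_hilbertFunction_le_and_eventually_eq (hdim : ringKrullDim R = 2)
    (hCM : IsCohenMacaulayLocal R) (hIm : ∀ i, I i ≤ maximalIdeal R)
    (hmI : ∀ i, ∃ k, maximalIdeal R ^ k ≤ I i)
    (hF : Module.Finite (extReesRing I) (extReesModule F)) (i j : Fin s) :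
    ∃ c, (∀ n, F.IsRatliffRushClosedAt n →
        Δ_[Pi.single j 1] (Δ_[Pi.single i 1] F.hilbertFunction) n ≤ c) ∧
      ∀ᶠ n in atTop, Δ_[Pi.single j 1] (Δ_[Pi.single i 1] F.hilbertFunction) n = c := by
  obtain ⟨a, haI, b, hbI, hab, hk, p₀, hcolon, hred⟩ := exists_joint_reduction hdim hCM hIm hmI
    F.multiPow_mul_ideal_le (IsMultiPowStable.isFiniteFamily_of_familyModule_fg _
      (Module.Finite.iff_fg.mp hF)) (fun _ => F.ideal_eq_top_of_nonpos) i j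
  obtain ⟨h, hh⟩ := F.exists_natCast_eq_hilbertFunction hmI
  obtain ⟨c, hc⟩ := ENat.ne_top_iff_exists.mp (length_quotient_ne_top hk)
  have hlength {n : Fin s → ℤ} (hn : (F.ideal (n + Pi.single j 1)).colon {b} ⊓
      (F.ideal (n + Pi.single i 1)).colon {a} ≤ F.ideal n) := by
    simpa only [(hh _).1, ← hc, ← Nat.cast_add] using
      F.length_quotient_add_length_quotient_of_colon_inf_colon_le haI hbI hab hn
  have hle (n : Fin s → ℤ) : Ideal.span {a} * F.ideal (n + Pi.single j 1) ⊔
      Ideal.span {b} * F.ideal (n + Pi.single i 1) ≤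
        F.ideal (n + Pi.single i 1 + Pi.single j 1) := by
    refine sup_le ?_ (F.span_singleton_mul_ideal_le hbI _)
    rw [add_right_comm]
    exact F.span_singleton_mul_ideal_le haI _
  refine ⟨c, fun n hn => ?_, (eventually_ge_atTop fun _ => p₀).mono fun n hn => ?_⟩
  · have hle' := add_le_add_left (length_quotient_anti (hle n)) (h n : ℕ∞)
    rw [hlength (F.colon_inf_colon_le_of_isRatliffRushClosedAt hred hn), (hh _).1, ← Nat.cast_add,
      Nat.cast_le] at hle'
    simp only [fwdDiff, (hh _).2, add_right_comm n (Pi.single j 1)]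
    omega
  · have heq := hlength (inf_le_right.trans (hcolon n (hn i)))
    rw [(hle n).antisymm (hred n (hn i) (hn j)), (hh _).1, ← Nat.cast_add, Nat.cast_inj] at heq
    simp only [fwdDiff, (hh _).2, add_right_comm n (Pi.single j 1)]
    omega

theorem hilbertPoly_one_eq (hdim : ringKrullDim R = 1)
    (hdepth : maximalIdeal R ∉ associatedPrimes R R) (hIm : ∀ i, I i ≤ maximalIdeal R)
    (hmI : ∀ i, ∃ k, maximalIdeal R ^ k ≤ I i)
    (hF : Module.Finite (extReesRing I) (extReesModule F)) (he : F.hilbertCoeff 1 0 ≤ 0)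
    {n : Fin s → ℤ} (hn : 0 ≤ n) : F.hilbertPoly 1 n = F.hilbertFunction n := by
  choose c hle hev using
    F.exists_fwdDiff_hilbertFunction_le_and_eventually_eq hdim hdepth hIm hmI hF
  have hP := F.eventually_hilbertPoly_eq
    (exists_eventually_numericalPoly_one_eq fun i => ⟨c i, hev i⟩)
  have hzero : (F.hilbertFunction - F.hilbertPoly 1) 0 ≤ 0 := by
    rw [Pi.sub_apply, F.hilbertFunction_of_nonpos le_rfl, hilbertPoly, numericalPoly_zero_right]
    linarith
  refine (sub_eq_zero.mp (eq_zero_of_fwdDiff_nonpos (fun n _ i => ?_) hzero ?_ hn)).symm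
  · exact fwdDiff_sub_nonpos_of_le_of_eventually_eq
      (fwdDiff_numericalPoly_one (F.hilbertCoeff 1) i) (hP.mono fun _ => Eq.symm) (hev i) (hle i n)
  · exact hP.mono fun _ h => sub_eq_zero.mpr h.symm

theorem hilbertPoly_two_eq (hdim : ringKrullDim R = 2) (hCM : IsCohenMacaulayLocal R)
    (hIm : ∀ i, I i ≤ maximalIdeal R) (hmI : ∀ i, ∃ k, maximalIdeal R ^ k ≤ I i)
    (hF : Module.Finite (extReesRing I) (extReesModule F))
    (he : ∀ i, F.hilbertCoeff 2 (Pi.single i 1) ≤ 0)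
    (hRR : ∀ n, 0 ≤ n → F.IsRatliffRushClosedAt n) :
    (∀ n, 0 ≤ n → F.hilbertPoly 2 n = F.hilbertFunction n) ∧ F.hilbertCoeff 2 0 = 0 := by
  choose c hle hev using
    F.exists_fwdDiff_fwdDiff_hilbertFunction_le_and_eventually_eq hdim hCM hIm hmI hF
  have hP : ∀ᶠ n in atTop, F.hilbertFunction n = F.hilbertPoly 2 n :=
    (F.eventually_hilbertPoly_eq (exists_eventually_numericalPoly_two_eq
      fun i j => ⟨c i j, hev i j⟩)).mono fun _ => Eq.symm
  set G := F.hilbertFunction - F.hilbertPoly 2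
  have hG : ∀ᶠ n in atTop, G n = 0 := hP.mono fun _ => sub_eq_zero.mpr
  have hΔΔG (i j : Fin s) (n : Fin s → ℤ) (hn : F.IsRatliffRushClosedAt n) :
      Δ_[Pi.single j 1] (Δ_[Pi.single i 1] G) n ≤ 0 := by
    have hsub : Δ_[Pi.single i 1] G =
        Δ_[Pi.single i 1] F.hilbertFunction - Δ_[Pi.single i 1] (F.hilbertPoly 2) :=
      funext (fwdDiff_sub_apply _ _ _)
    rw [hsub]
    exact fwdDiff_sub_nonpos_of_le_of_eventually_eq
      (fwdDiff_fwdDiff_numericalPoly_two (F.hilbertCoeff 2) i j) (eventually_fwdDiff_eq hP i)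
      (hev i j) (hle i j n hn)
  have hΔG (n : Fin s → ℤ) (hn : 0 ≤ n) (i : Fin s) : Δ_[Pi.single i 1] G n = 0 := by
    refine eq_zero_of_fwdDiff_nonpos (fun n hn j => hΔΔG i j n (hRR n hn))
      (F.fwdDiff_hilbertFunction_sub_hilbertPoly_two_zero_nonpos (he i) (hΔΔG i i)) ?_ hn
    refine (eventually_fwdDiff_eq (h := 0) hG i).mono fun n hn => ?_
    rw [hn, fwdDiff, Pi.zero_apply, Pi.zero_apply, sub_zero]
  have hG0 : G 0 = 0 := by
    obtain ⟨m, hm, hm0⟩ := (hG.and (eventually_ge_atTop 0)).exists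
    rw [← eq_of_fwdDiff_eq_zero hΔG hm0, hm]
  refine ⟨fun n hn => (sub_eq_zero.mp ((eq_of_fwdDiff_eq_zero hΔG hn).trans hG0)).symm, ?_⟩
  have hP0 : F.hilbertPoly 2 0 = 0 :=
    (sub_eq_zero.mp hG0).symm.trans (F.hilbertFunction_of_nonpos le_rfl)
  rwa [hilbertPoly, numericalPoly_zero_right, neg_one_sq, one_mul] at hP0

end MultiFiltration

end HilbertFunction

end

theorem theorem4p5_general {R : Type*} [CommRing R] [IsLocalRing R] [IsNoetherianRing R]
    (hCM : IsCohenMacaulayLocal R)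
    (hres : Infinite (ResidueField R))
    (d : ℕ) (hd : ringKrullDim R = d)
    (s : ℕ) (hs : 1 ≤ s) (I : Fin s → Ideal R)
    (hI : ∀ i, (I i).radical = maximalIdeal R)
    (F : MultiFiltration I)
    (hF : Module.Finite (extReesRing I) (extReesModule F))
    (he : ∀ i : Fin s, F.hilbertCoeff d (Pi.single i (d - 1)) ≤ 0) :
    (d = 1 → ∀ n : Fin s → ℤ, 0 ≤ n → F.hilbertPoly d n = F.hilbertFunction n) ∧
    (d = 2 →
      ∀ (m : ℕ) (x : Fin m → reesRing I) (δ : Fin m → (Fin s → ℤ)),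
        (∀ j, IsLaurentHomogeneous (δ j) (x j : LaurentRing R s)) →
        Ideal.span (Set.range x) = reesIrrelevant I →
        (∀ n : Fin s → ℤ, 0 ≤ n →
          cechH1Component (M := reesModule F) x (reesComponent F) δ n = ⊥) →
        (∀ n : Fin s → ℤ, 0 ≤ n → F.hilbertPoly d n = F.hilbertFunction n) ∧
          F.hilbertCoeff d 0 = 0) := by
  have hIm : ∀ i, I i ≤ maximalIdeal R := fun i => (hI i).le.trans' Ideal.le_radical
  have hmI : ∀ i, ∃ k, maximalIdeal R ^ k ≤ I i := fun i =>
    Ideal.exists_pow_le_of_le_radical_of_fg (hI i).ge (IsNoetherian.noetherian _)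
  refine ⟨?_, ?_⟩
  · rintro rfl n hn
    obtain ⟨y, hy, hyreg⟩ := hCM.exists_nonZeroDivisor hd le_rfl
    refine F.hilbertPoly_one_eq (by simpa using hd)
      (maximalIdeal_notMem_associatedPrimes hy hyreg) hIm hmI hF ?_ hn
    simpa using he ⟨0, hs⟩
  · rintro rfl m x δ hhom hspan hbot
    obtain ⟨y, hy, hyreg⟩ := hCM.exists_nonZeroDivisor hd one_le_two
    obtain ⟨q, hq⟩ := exists_pow_le_multiPow hmI 1
    exact F.hilbertPoly_two_eq (by simpa using hd) hCM hIm hmI hF he fun n hn =>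
      F.isRatliffRushClosedAt_of_cechH1Component_eq_bot
        ⟨y ^ q, hq (Ideal.pow_mem_pow hy q), pow_mem hyreg q⟩ hhom hspan hn (hbot n hn)

theorem theorem4p5 {R : Type*} [CommRing R] [IsLocalRing R] [IsNoetherianRing R]
    (hCM : IsCohenMacaulayLocal R)
    (hres : Infinite (IsLocalRing.ResidueField R))
    (d : ℕ) (hd : ringKrullDim R = d) (hd1 : 1 ≤ d) (hd2 : d ≤ 2)
    (s : ℕ) (hs : 1 ≤ s) (I : Fin s → Ideal R)
    (hI : ∀ i, (I i).radical = IsLocalRing.maximalIdeal R)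
    (F : MultiFiltration I) (hF : F.IsAdmissible)
    (he : ∀ i : Fin s, F.hilbertCoeff d (Pi.single i (d - 1)) = 0) :
    (d = 1 → ∀ n : Fin s → ℤ, 0 ≤ n → F.hilbertPoly d n = F.hilbertFunction n) ∧
    (d = 2 →
      -- the local cohomology with support in `R(I)₊₊` is computed on an arbitrary finite system
      -- of homogeneous generators of this ideal
      ∀ (m : ℕ) (x : Fin m → reesRing I) (δ : Fin m → (Fin s → ℤ)),
        (∀ j, IsLaurentHomogeneous (δ j) (x j : LaurentRing R s)) →
        Ideal.span (Set.range x) = reesIrrelevant I →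
        (∀ n : Fin s → ℤ, 0 ≤ n →
          cechH1Component (M := reesModule F) x (reesComponent F) δ n = ⊥) →
        (∀ n : Fin s → ℤ, 0 ≤ n → F.hilbertPoly d n = F.hilbertFunction n) ∧
          F.hilbertCoeff d 0 = 0) :=
  theorem4p5_general hCM hres d hd s hs I hI F hF.2 fun i => (he i).le
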